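/- Let $k\le n$, let $A$ be an $n\times k$ matrix with integer entries, and let the torus $T^k=\{e^{iv}:v\in\mathbb R^k\}$ act on $\mathbb C^n$ by $\rho(e^{iv})z=e^{iAv}z$. Let $\mathfrak t^k=i\mathbb R^k$ carry its standard inner product, write $L_z\xi=\dot\rho(\xi)z$ for $\xi\in\mathfrak t^k$, and let $\mu:\mathbb C^n\to\mathfrak t^k$ be the moment map with $\mu(0)=0$ and $d\langle\mu,\xi\rangle=\omega(L_z\xi,\cdot)$, $\omega=\sum_j dx_j\wedge dy_j$, that is, $\mu(z)=-\tfrac i2A^T(|z_1|^2,\dots,|z_n|^2)^T$. Assume that $\mu$ is proper and that $\tau\in\mathfrak t^k$ is a regular value of $\mu$. Let $S^1=\mathbb R/\mathbb Z$, $\mathscr L=C^\infty(S^1,\mathbb C^n\times\mathfrak t^k)$ and $\mathscr L_0=C^\infty(S^1,\mathbb C^n)\times\mathfrak t^k\subset\mathscr L$ (constant second component). For $z\in C^\infty(S^1,\mathbb C^n)$ put $\bar\mu(z)=\int_0^1\mu(z(t))\,dt$, and let $$\mathcal A_0(z,\eta)=\int_0^1\sum_j y_j\,\partial_t x_j\,dt+\langle\eta,\bar\mu(z)-\tau\rangle,\qquad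 (z,\eta)\in\mathscr L_0,\ z=x+iy.$$ For $r\in(0,1]$ let the group $\mathcal H_0$ of gauge transformations $h=\exp\xi$, where $\xi\in C^\infty(S^1,\mathfrak t^k)$ and $\int_0^1\xi\,dt=0$, act on $\mathscr L$ by $h_{*_r}(z,\eta)=(\rho(h)z,\ \eta-\tfrac1r h^{-1}\partial_th)$. Each orbit meets $\mathscr L_0$ in exactly one point. Let $g_r$ be the metric on $\mathscr L_0\cong\mathscr L/_r\mathcal H_0$ induced as quotient metric by the $L^2$-metric on $\mathscr L$. A flow line of $\mathcal A_0$ with respect to $g_r$ is a pair $(z,\eta)\in C^\infty(\mathbb R\times S^1,\mathbb C^n)\times C^\infty(\mathbb R,\mathfrak t^k)$ such that $\partial_s(z,\eta)(s)=-\nabla_r\mathcal A_0((z,\eta)(s))$ for all $s\in\mathbb R$, where $\nabla_r$ is the gradient with respect to $g_r$. Its energy is $$E(z,\eta)=\int_{-\infty}^\infty\int_0^1\big(\|\partial_tz+L_z\eta\|^2+\|\bar\mu(z)-\tau\|^2\big)\,dt\,ds.$$ Then there is a compact set $K\subset\mathbb C^n$ such that for every $r\in(0,1]$ and every flow line $(z,\eta)$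 of $\mathcal A_0$ with respect to $g_r$ with $E(z,\eta)<\infty$, $$z(s,t)\in K\qquad\text{for all } s\in\mathbb R,\ t\in S^1.$$ -/

import Mathlib

noncomputable section

namespace MomentFloer

open scoped ContDiff

/-- The symplectic vector space `ℂⁿ`. -/
abbrev CSpace (n : ℕ) : Type := EuclideanSpace ℂ (Fin n)

/-- The Lie algebra `𝔱ᵏ = iℝᵏ` of the torus, with its standard inner product; the element `iv` is
represented by the real vector `v`. -/
abbrev TorusLie (k : ℕ) : Type := EuclideanSpace ℝ (Fin k)

variable {n k : ℕ}

/-- The `j`-th entry of the real vector `Aξ`. -/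
def weight (A : Matrix (Fin n) (Fin k) ℤ) (ξ : TorusLie k) (j : Fin n) : ℝ :=
  ∑ l, (A j l : ℝ) * ξ l

/-- The action `ρ(exp ξ) z = e^{iAξ} z` of the torus on `ℂⁿ`. -/
def torusAction (A : Matrix (Fin n) (Fin k) ℤ) (ξ : TorusLie k) (z : CSpace n) : CSpace n :=
  WithLp.toLp 2 fun j => Complex.exp (Complex.I * (weight A ξ j : ℂ)) * z j

/-- The infinitesimal action `L_z ξ = X_ξ(z)`. -/
def infAction (A : Matrix (Fin n) (Fin k) ℤ) (z : CSpace n) (ξ : TorusLie k) : CSpace n :=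
  WithLp.toLp 2 fun j => Complex.I * (weight A ξ j : ℂ) * z j

/-- The standard symplectic form `ω = ∑ dxⱼ ∧ dyⱼ`. -/
def symplecticForm (v w : CSpace n) : ℝ :=
  ∑ j, ((v j).re * (w j).im - (v j).im * (w j).re)

/-- The moment map of the torus action, normalized by `μ(0) = 0` and `d⟨μ, ξ⟩ = ω(X_ξ, ·)`
(see `hasDerivAt_inner_momentMap`). -/
def momentMap (A : Matrix (Fin n) (Fin k) ℤ) (z : CSpace n) : TorusLie k :=
  WithLp.toLp 2 fun l => -(1 / 2 : ℝ) * ∑ j, (A j l : ℝ) * ‖z j‖ ^ 2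

/-- `τ` is a regular value of `f`. -/
def IsRegularValue (f : CSpace n → TorusLie k) (τ : TorusLie k) : Prop :=
  ∀ z, f z = τ → Function.Surjective (fderiv ℝ f z)

/-- Smooth loops `S¹ = ℝ/ℤ → E`, as smooth `1`-periodic maps on `ℝ`. -/
def IsSmoothLoop {E : Type*} [NormedAddCommGroup E] [NormedSpace ℝ E] (f : ℝ → E) : Prop :=
  ContDiff ℝ ∞ f ∧ Function.Periodic f 1

/-- The Lie algebra of the group `ℋ₀` of normalized gauge transformations `exp ξ`. -/
def lieGauge (k : ℕ) : Set (ℝ → TorusLie k) :=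
  {ξ | IsSmoothLoop ξ ∧ ∫ t in (0 : ℝ)..1, ξ t = 0}

/-- The inclusion `ι` of `ℒ₀` (loops whose `𝔱ᵏ`-component is constant) into the space `ℒ` of loops
in `ℂⁿ × 𝔱ᵏ`; also used for tangent vectors. -/
def incl (p : (ℝ → CSpace n) × TorusLie k) : (ℝ → CSpace n) × (ℝ → TorusLie k) :=
  (p.1, fun _ => p.2)

/-- The moment action functional on `ℒ`, where the Liouville form is `λ = ∑ yⱼ dxⱼ`. -/
def action (A : Matrix (Fin n) (Fin k) ℤ) (τ : TorusLie k)
    (p : (ℝ → CSpace n) × (ℝ → TorusLie k)) : ℝ :=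
  (∫ t in (0 : ℝ)..1, ∑ j, (p.1 t j).im * (deriv p.1 t j).re) +
    ∫ t in (0 : ℝ)..1, inner ℝ (momentMap A (p.1 t) - τ) (p.2 t)

/-- The restriction `𝒜₀ = ι^* 𝒜`. -/
def action₀ (A : Matrix (Fin n) (Fin k) ℤ) (τ : TorusLie k)
    (p : (ℝ → CSpace n) × TorusLie k) : ℝ :=
  action A τ (incl p)

/-- The `L²`-metric `g` on `ℒ`. -/
def l2Metric (v w : (ℝ → CSpace n) × (ℝ → TorusLie k)) : ℝ :=
  ∫ t in (0 : ℝ)..1, ((inner ℂ (v.1 t) (w.1 t)).re + inner ℝ (v.2 t) (w.2 t))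

/-- The action on `ℒ` of the gauge transformation `exp ξ ∈ ℋ₀`, deformed by the parameter `r`. -/
def gaugeAction (A : Matrix (Fin n) (Fin k) ℤ) (r : ℝ) (ξ : ℝ → TorusLie k)
    (p : (ℝ → CSpace n) × (ℝ → TorusLie k)) : (ℝ → CSpace n) × (ℝ → TorusLie k) :=
  (fun t => torusAction A (ξ t) (p.1 t), fun t => p.2 t - (1 / r) • deriv ξ t)

/-- The infinitesimal deformed gauge action of `ξ ∈ Lie(ℋ₀)` at a point of `ℒ` with first
component `z` (see `hasDerivAt_gaugeAction`). -/
def infGauge (A : Matrix (Fin n) (Fin k) ℤ) (r : ℝ) (z : ℝ → CSpace n) (ξ : ℝ → TorusLie k) :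
    (ℝ → CSpace n) × (ℝ → TorusLie k) :=
  (fun t => infAction A (z t) (ξ t), fun t => -((1 / r) • deriv ξ t))

/-- The squared length of the class of `v ∈ T_{(z,η)} ℒ` in the quotient of `ℒ` by the deformed
action of `ℋ₀`: the infimum of the squared `L²`-length over all representatives of that class. -/
def quotientLengthSq (A : Matrix (Fin n) (Fin k) ℤ) (r : ℝ) (z : ℝ → CSpace n)
    (v : (ℝ → CSpace n) × (ℝ → TorusLie k)) : ℝ :=
  sInf ((fun ξ => l2Metric (v - infGauge A r z ξ) (v - infGauge A r z ξ)) '' lieGauge k)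

/-- The metric `g_r` on `ℒ₀` at a point with first component `z`: the pull-back, to
`ℒ₀ ≅ ℒ /_r ℋ₀`, of the quotient metric of `g`, obtained from the quotient length by polarization
(it is the `L²`-product of the horizontal representatives, see `quotientMetric_eq`). -/
def quotientMetric (A : Matrix (Fin n) (Fin k) ℤ) (r : ℝ) (z : ℝ → CSpace n)
    (v w : (ℝ → CSpace n) × TorusLie k) : ℝ :=
  (quotientLengthSq A r z (incl (v + w)) - quotientLengthSq A r z (incl (v - w))) / 4

/-- `v ∈ T_p ℒ₀` is the gradient of `𝒜₀` at `p ∈ ℒ₀` with respect to `g_r`, i.e.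
`d𝒜₀(p) w = g_r(v, w)` for all `w ∈ T_p ℒ₀`. -/
def IsGradient (A : Matrix (Fin n) (Fin k) ℤ) (τ : TorusLie k) (r : ℝ)
    (p v : (ℝ → CSpace n) × TorusLie k) : Prop :=
  IsSmoothLoop v.1 ∧ ∀ w : (ℝ → CSpace n) × TorusLie k, IsSmoothLoop w.1 →
    HasDerivAt (fun ε : ℝ => action₀ A τ (p + ε • w)) (quotientMetric A r p.1 v w) 0

/-- `(z, η)` is a (negative) gradient flow line `ℝ → ℒ₀` of `𝒜₀` with respect to `g_r`. -/
structure IsFlowLine (A : Matrix (Fin n) (Fin k) ℤ) (τ : TorusLie k) (r : ℝ)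
    (z : ℝ → ℝ → CSpace n) (η : ℝ → TorusLie k) : Prop where
  smooth_fst : ContDiff ℝ ∞ fun p : ℝ × ℝ => z p.1 p.2
  smooth_snd : ContDiff ℝ ∞ η
  periodic : ∀ s, Function.Periodic (z s) 1
  flow : ∀ s, IsGradient A τ r (z s, η s) (-(fun t => deriv (fun σ => z σ t) s, deriv η s))

/-- The mean value `μ̄(z)` of the moment map along a loop. -/
def meanMoment (A : Matrix (Fin n) (Fin k) ℤ) (z : ℝ → CSpace n) : TorusLie k :=
  ∫ t in (0 : ℝ)..1, momentMap A (z t)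

/-- The energy of `(z, η)`, possibly infinite. -/
def energy (A : Matrix (Fin n) (Fin k) ℤ) (τ : TorusLie k)
    (z : ℝ → ℝ → CSpace n) (η : ℝ → TorusLie k) : ENNReal :=
  ∫⁻ s : ℝ, ∫⁻ t in Set.Icc (0 : ℝ) 1, ENNReal.ofReal
    (‖deriv (z s) t + infAction A (z s t) (η s)‖ ^ 2 + ‖meanMoment A (z s) - τ‖ ^ 2)

/-! Checks of the conventions. -/

theorem hasDerivAt_inner_momentMap (A : Matrix (Fin n) (Fin k) ℤ) (ξ : TorusLie k)
    (z w : CSpace n) :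
    HasDerivAt (fun ε : ℝ => inner ℝ (momentMap A (z + ε • w)) ξ)
      (symplecticForm (infAction A z ξ) w) 0 := by
  have key : ∀ ε : ℝ, inner ℝ (momentMap A (z + ε • w)) ξ =
      ∑ j, -(1 / 2 : ℝ) * weight A ξ j *
        (((z j).re + ε * (w j).re) ^ 2 + ((z j).im + ε * (w j).im) ^ 2) := by
    intro ε
    simp only [momentMap, weight, PiLp.inner_apply, RCLike.inner_apply, conj_trivial,
      Finset.mul_sum, Finset.sum_mul]
    rw [Finset.sum_comm]
    refine Finset.sum_congr rfl fun j _ => Finset.sum_congr rfl fun l _ => ?_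
    rw [Complex.sq_norm, Complex.normSq_apply]
    simp
    ring
  simp only [key, symplecticForm]
  refine HasDerivAt.fun_sum fun j _ => ?_
  have h1 : HasDerivAt (fun ε : ℝ => (z j).re + ε * (w j).re) (w j).re 0 := by
    simpa using ((hasDerivAt_id (0 : ℝ)).mul_const (w j).re).const_add (z j).re
  have h2 : HasDerivAt (fun ε : ℝ => (z j).im + ε * (w j).im) (w j).im 0 := by
    simpa using ((hasDerivAt_id (0 : ℝ)).mul_const (w j).im).const_add (z j).im
  refine HasDerivAt.congr_deriv
    (((h1.pow 2).add (h2.pow 2)).const_mul (-(1 / 2 : ℝ) * weight A ξ j)) ?_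
  simp [infAction]
  ring

theorem hasDerivAt_gaugeAction (A : Matrix (Fin n) (Fin k) ℤ) (r : ℝ) {ξ : ℝ → TorusLie k}
    (hξ : ξ ∈ lieGauge k) (p : (ℝ → CSpace n) × (ℝ → TorusLie k)) (t : ℝ) :
    HasDerivAt (fun ε : ℝ => (gaugeAction A r (ε • ξ) p).1 t) ((infGauge A r p.1 ξ).1 t) 0 ∧
    HasDerivAt (fun ε : ℝ => (gaugeAction A r (ε • ξ) p).2 t) ((infGauge A r p.1 ξ).2 t) 0 := by
  constructor
  · refine ((PiLp.continuousLinearEquiv 2 ℝ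
      (fun _ : Fin n => ℂ)).symm.hasFDerivAt).comp_hasDerivAt 0 (hasDerivAt_pi.2 fun j => ?_)
    have hw : ∀ ε : ℝ, weight A ((ε • ξ) t) j = ε * weight A (ξ t) j := fun ε => by
      simp only [weight, Pi.smul_apply, PiLp.smul_apply, smul_eq_mul, Finset.mul_sum]
      exact Finset.sum_congr rfl fun l _ => by ring
    simp only [hw]
    have h0 : HasDerivAt (fun ε : ℝ => ((ε * weight A (ξ t) j : ℝ) : ℂ))
        ((weight A (ξ t) j : ℝ) : ℂ) 0 := by
      simpa using ((hasDerivAt_id (0 : ℝ)).mul_const (weight A (ξ t) j)).ofReal_comp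
    simpa using ((h0.const_mul Complex.I).cexp).mul_const (p.1 t j)
  · have hd : DifferentiableAt ℝ ξ t := hξ.1.1.differentiable (by simp) t
    have hs : ∀ ε : ℝ, deriv (ε • ξ) t = ε • deriv ξ t := fun ε => deriv_const_smul ε hd
    simp only [gaugeAction, infGauge, hs]
    have := (((hasDerivAt_id (0 : ℝ)).smul_const (deriv ξ t)).const_smul (1 / r)).const_sub (p.2 t)
    simpa using this

theorem l2Metric_add_left {u v w : (ℝ → CSpace n) × (ℝ → TorusLie k)}
    (hu : Continuous u.1 ∧ Continuous u.2) (hv : Continuous v.1 ∧ Continuous v.2)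
    (hw : Continuous w.1 ∧ Continuous w.2) :
    l2Metric (u + v) w = l2Metric u w + l2Metric v w := by
  obtain ⟨hu1, hu2⟩ := hu
  obtain ⟨hv1, hv2⟩ := hv
  obtain ⟨hw1, hw2⟩ := hw
  unfold l2Metric
  rw [← intervalIntegral.integral_add]
  · refine intervalIntegral.integral_congr fun t _ => ?_
    simp [inner_add_left]
    ring
  · exact ((Complex.continuous_re.comp (hu1.inner hw1)).add (hu2.inner hw2)).intervalIntegrable _ _
  · exact ((Complex.continuous_re.comp (hv1.inner hw1)).add (hv2.inner hw2)).intervalIntegrable _ _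

theorem l2Metric_neg_left (u w : (ℝ → CSpace n) × (ℝ → TorusLie k)) :
    l2Metric (-u) w = -l2Metric u w := by
  unfold l2Metric
  rw [← intervalIntegral.integral_neg]
  refine intervalIntegral.integral_congr fun t _ => ?_
  simp
  ring

theorem l2Metric_comm (u w : (ℝ → CSpace n) × (ℝ → TorusLie k)) :
    l2Metric u w = l2Metric w u := by
  unfold l2Metric
  refine intervalIntegral.integral_congr fun t _ => ?_
  rw [← inner_conj_symm, Complex.conj_re, real_inner_comm]

theorem l2Metric_self_nonneg (u : (ℝ → CSpace n) × (ℝ → TorusLie k)) : 0 ≤ l2Metric u u :=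
  intervalIntegral.integral_nonneg zero_le_one fun _ _ =>
    add_nonneg (inner_self_nonneg (𝕜 := ℂ)) real_inner_self_nonneg

theorem continuous_infGauge (A : Matrix (Fin n) (Fin k) ℤ) (r : ℝ) {z : ℝ → CSpace n}
    (hz : IsSmoothLoop z) {ξ : ℝ → TorusLie k} (hξ : ξ ∈ lieGauge k) :
    Continuous (infGauge A r z ξ).1 ∧ Continuous (infGauge A r z ξ).2 := by
  have h1 := hz.1.continuous
  have h2 := hξ.1.1.continuous
  have h3 : Continuous (deriv ξ) := hξ.1.1.continuous_deriv (by simp)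
  constructor
  · simp only [infGauge, infAction, weight]
    fun_prop
  · simp only [infGauge]
    fun_prop

theorem lieGauge_add {ξ ζ : ℝ → TorusLie k} (hξ : ξ ∈ lieGauge k) (hζ : ζ ∈ lieGauge k) :
    ξ + ζ ∈ lieGauge k := by
  refine ⟨⟨hξ.1.1.add hζ.1.1, hξ.1.2.add hζ.1.2⟩, ?_⟩
  have := intervalIntegral.integral_add (hξ.1.1.continuous.intervalIntegrable 0 1)
    (hζ.1.1.continuous.intervalIntegrable 0 1) (μ := MeasureTheory.volume)
  simpa [hξ.2, hζ.2] using this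

theorem lieGauge_neg {ξ : ℝ → TorusLie k} (hξ : ξ ∈ lieGauge k) : -ξ ∈ lieGauge k := by
  refine ⟨⟨hξ.1.1.neg, fun t => by simp [hξ.1.2 t]⟩, ?_⟩
  simpa using hξ.2

theorem infGauge_add (A : Matrix (Fin n) (Fin k) ℤ) (r : ℝ) (z : ℝ → CSpace n)
    {ξ ζ : ℝ → TorusLie k} (hξ : ξ ∈ lieGauge k) (hζ : ζ ∈ lieGauge k) :
    infGauge A r z (ξ + ζ) = infGauge A r z ξ + infGauge A r z ζ := by
  refine Prod.ext (funext fun t => ?_) (funext fun t => ?_)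
  · ext j
    simp [infGauge, infAction, weight, mul_add, add_mul, Finset.sum_add_distrib]
  · have h1 : DifferentiableAt ℝ ξ t := hξ.1.1.differentiable (by simp) t
    have h2 : DifferentiableAt ℝ ζ t := hζ.1.1.differentiable (by simp) t
    simp only [infGauge, deriv_add h1 h2, Prod.snd_add, Pi.add_apply, smul_add, neg_add]

theorem infGauge_neg (A : Matrix (Fin n) (Fin k) ℤ) (r : ℝ) (z : ℝ → CSpace n)
    (ξ : ℝ → TorusLie k) : infGauge A r z (-ξ) = -infGauge A r z ξ := by
  refine Prod.ext (funext fun t => ?_) (funext fun t => ?_)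
  · ext j
    simp [infGauge, infAction, weight]
  · simp [infGauge, deriv.neg]

/-- The quotient length is the length of a horizontal representative, if there is one. -/
theorem quotientLengthSq_eq (A : Matrix (Fin n) (Fin k) ℤ) (r : ℝ) {z : ℝ → CSpace n}
    (hz : IsSmoothLoop z) {h : (ℝ → CSpace n) × (ℝ → TorusLie k)}
    (hh : Continuous h.1 ∧ Continuous h.2) {ξ : ℝ → TorusLie k} (hξ : ξ ∈ lieGauge k)
    (hor : ∀ χ ∈ lieGauge k, l2Metric h (infGauge A r z χ) = 0) :
    quotientLengthSq A r z (h + infGauge A r z ξ) = l2Metric h h := by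
  refine IsLeast.csInf_eq ⟨⟨ξ, hξ, by simp⟩, ?_⟩
  rintro _ ⟨χ, hχ, rfl⟩
  have e : h + infGauge A r z ξ - infGauge A r z χ = h + infGauge A r z (ξ + -χ) := by
    rw [infGauge_add A r z hξ (lieGauge_neg hχ), infGauge_neg]
    abel
  have hm := lieGauge_add hξ (lieGauge_neg hχ)
  have hG := continuous_infGauge A r hz hm
  have hs : Continuous (h + infGauge A r z (ξ + -χ)).1 ∧
      Continuous (h + infGauge A r z (ξ + -χ)).2 := ⟨hh.1.add hG.1, hh.2.add hG.2⟩
  simp only [e]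
  rw [l2Metric_add_left hh hG hs, l2Metric_comm h (_ + _),
    l2Metric_comm (infGauge A r z _) (_ + _), l2Metric_add_left hh hG hh,
    l2Metric_add_left hh hG hG, l2Metric_comm (infGauge A r z _) h, hor _ hm]
  linarith [l2Metric_self_nonneg (infGauge A r z (ξ + -χ))]

/-- At a point of `ℒ₀`, `g_r` is the `L²`-product of the horizontal representatives. -/
theorem quotientMetric_eq (A : Matrix (Fin n) (Fin k) ℤ) (r : ℝ) {z : ℝ → CSpace n}
    (hz : IsSmoothLoop z) {v w : (ℝ → CSpace n) × TorusLie k}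
    (hv : IsSmoothLoop v.1) (hw : IsSmoothLoop w.1) {ξ ζ : ℝ → TorusLie k}
    (hξ : ξ ∈ lieGauge k) (hζ : ζ ∈ lieGauge k)
    (hvξ : ∀ χ ∈ lieGauge k, l2Metric (incl v - infGauge A r z ξ) (infGauge A r z χ) = 0)
    (hwζ : ∀ χ ∈ lieGauge k, l2Metric (incl w - infGauge A r z ζ) (infGauge A r z χ) = 0) :
    quotientMetric A r z v w =
      l2Metric (incl v - infGauge A r z ξ) (incl w - infGauge A r z ζ) := by
  have hGξ := continuous_infGauge A r hz hξ
  have hGζ := continuous_infGauge A r hz hζ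
  obtain ⟨a, ha⟩ : ∃ a, a = incl v - infGauge A r z ξ := ⟨_, rfl⟩
  obtain ⟨b, hb⟩ : ∃ b, b = incl w - infGauge A r z ζ := ⟨_, rfl⟩
  have hac : Continuous a.1 ∧ Continuous a.2 := by
    rw [ha]; exact ⟨hv.1.continuous.sub hGξ.1, continuous_const.sub hGξ.2⟩
  have hbc : Continuous b.1 ∧ Continuous b.2 := by
    rw [hb]; exact ⟨hw.1.continuous.sub hGζ.1, continuous_const.sub hGζ.2⟩
  have hnc : Continuous (-b).1 ∧ Continuous (-b).2 := ⟨hbc.1.neg, hbc.2.neg⟩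
  rw [← ha] at hvξ ⊢
  rw [← hb] at hwζ ⊢
  have e1 : incl (v + w) = (a + b) + infGauge A r z (ξ + ζ) := by
    rw [infGauge_add A r z hξ hζ, ha, hb, show incl (v + w) = incl v + incl w from rfl]
    abel
  have e2 : incl (v - w) = (a + -b) + infGauge A r z (ξ + -ζ) := by
    rw [infGauge_add A r z hξ (lieGauge_neg hζ), infGauge_neg, ha, hb,
      show incl (v - w) = incl v - incl w from rfl]
    abel
  have hsc : Continuous (a + b).1 ∧ Continuous (a + b).2 := ⟨hac.1.add hbc.1, hac.2.add hbc.2⟩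
  have hdc : Continuous (a + -b).1 ∧ Continuous (a + -b).2 := ⟨hac.1.add hnc.1, hac.2.add hnc.2⟩
  unfold quotientMetric
  rw [e1, e2, quotientLengthSq_eq A r hz hsc (lieGauge_add hξ hζ),
    quotientLengthSq_eq A r hz hdc (lieGauge_add hξ (lieGauge_neg hζ)),
    l2Metric_add_left hac hbc hsc, l2Metric_comm a (a + b), l2Metric_comm b (a + b),
    l2Metric_add_left hac hbc hac, l2Metric_add_left hac hbc hbc,
    l2Metric_add_left hac hnc hdc, l2Metric_comm a (a + -b), l2Metric_neg_left,
    l2Metric_comm b (a + -b), l2Metric_add_left hac hnc hac, l2Metric_add_left hac hnc hbc,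
    l2Metric_neg_left, l2Metric_neg_left, l2Metric_comm b a]
  · ring
  · intro χ hχ
    rw [l2Metric_add_left hac hnc (continuous_infGauge A r hz hχ), l2Metric_neg_left, hvξ χ hχ,
      hwζ χ hχ]
    simp
  · intro χ hχ
    rw [l2Metric_add_left hac hbc (continuous_infGauge A r hz hχ), hvξ χ hχ, hwζ χ hχ]
    simp

end MomentFloer

end

/-! The gradient of `𝒜₀` for the quotient metric `g_r` is obtained from its horizontal lift
`(i(∂ₜz + L_z η), μ̄ - τ + r(μ - μ̄))` by adding the infinitesimal gauge transformation whose
potential has mean zero and derivative `r²(μ - μ̄)`; this brings the second component back to a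
constant. Along a flow line it follows that
`Δ‖z‖² = 4‖∂ₜz + L_z η‖² + 4⟨μ, μ̄ - τ + r²(μ - μ̄)⟩` on `ℝ × S¹`.

Since `μ` is homogeneous and proper, `‖z‖² ≤ c‖μ(z)‖`, and the same holds for the means over a
loop. Hence `m(s) = ∫ ‖z(s, t)‖² dt` satisfies `∂ₛ²m > 0` wherever `m > c(‖τ‖ + 1)`. Finite energy
makes `m ≤ c(‖τ‖ + 1)` for some `s` arbitrarily close to `-∞` and to `+∞`, so the maximum principle
gives this bound for all `s`.

It remains to pass from `L²`-bounds on circles to pointwise bounds. With the bound on `m` one gets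
`Δ‖z‖² ≥ -C‖z‖²` for a constant `C` independent of the flow line. As `m` is bounded, every interval
of length `1/(C + 1)` contains an `s` where `∂ₛ²m`, and therefore `∫ ‖∂ₜz + L_z η‖² dt`, is
bounded; on that circle `‖z‖²` is bounded pointwise. Between two such circles on either side of
`s₀` the supersolution `2 - (C + 1)(s - s₀)²` propagates the bound.
-/

noncomputable section

namespace MomentFloer

open scoped ContDiff

section TwoVariables

variable {E : Type*} [NormedAddCommGroup E] [NormedSpace ℝ E] {f : ℝ → ℝ → E}

theorem hasDerivAt_partial_fst {s t : ℝ}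
    (hf : DifferentiableAt ℝ (fun p : ℝ × ℝ => f p.1 p.2) (s, t)) :
    HasDerivAt (fun σ => f σ t) (fderiv ℝ (fun p : ℝ × ℝ => f p.1 p.2) (s, t) (1, 0)) s :=
  hf.hasFDerivAt.comp_hasDerivAt (f := fun σ => (σ, t)) s
    ((hasDerivAt_id s).prodMk (hasDerivAt_const s t))

theorem hasDerivAt_partial_snd {s t : ℝ}
    (hf : DifferentiableAt ℝ (fun p : ℝ × ℝ => f p.1 p.2) (s, t)) :
    HasDerivAt (f s) (fderiv ℝ (fun p : ℝ × ℝ => f p.1 p.2) (s, t) (0, 1)) t :=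
  hf.hasFDerivAt.comp_hasDerivAt (f := fun y => (s, y)) t
    ((hasDerivAt_const t s).prodMk (hasDerivAt_id t))

theorem contDiff_partial_fst {m n : WithTop ℕ∞} (hf : ContDiff ℝ n fun p : ℝ × ℝ => f p.1 p.2)
    (hmn : m + 1 ≤ n) : ContDiff ℝ m fun p : ℝ × ℝ => deriv (fun σ => f σ p.2) p.1 := by
  have hd : Differentiable ℝ fun p : ℝ × ℝ => f p.1 p.2 :=
    (hf.of_le (le_add_self.trans hmn)).differentiable one_ne_zero
  have heq : (fun p : ℝ × ℝ => deriv (fun σ => f σ p.2) p.1) =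
      fun p => fderiv ℝ (fun p : ℝ × ℝ => f p.1 p.2) p (1, 0) :=
    funext fun p => (hasDerivAt_partial_fst (hd p)).deriv
  rw [heq]
  exact (hf.fderiv_right hmn).clm_apply contDiff_const

theorem contDiff_partial_snd {m n : WithTop ℕ∞} (hf : ContDiff ℝ n fun p : ℝ × ℝ => f p.1 p.2)
    (hmn : m + 1 ≤ n) : ContDiff ℝ m fun p : ℝ × ℝ => deriv (f p.1) p.2 := by
  have hd : Differentiable ℝ fun p : ℝ × ℝ => f p.1 p.2 :=
    (hf.of_le (le_add_self.trans hmn)).differentiable one_ne_zero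
  have heq : (fun p : ℝ × ℝ => deriv (f p.1) p.2) =
      fun p => fderiv ℝ (fun p : ℝ × ℝ => f p.1 p.2) p (0, 1) :=
    funext fun p => (hasDerivAt_partial_snd (hd p)).deriv
  rw [heq]
  exact (hf.fderiv_right hmn).clm_apply contDiff_const

theorem contDiff_slice_fst {n : WithTop ℕ∞} (hf : ContDiff ℝ n fun p : ℝ × ℝ => f p.1 p.2)
    (t : ℝ) : ContDiff ℝ n fun σ => f σ t :=
  hf.comp (contDiff_prodMk_left t)

theorem contDiff_slice_snd {n : WithTop ℕ∞} (hf : ContDiff ℝ n fun p : ℝ × ℝ => f p.1 p.2)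
    (s : ℝ) : ContDiff ℝ n (f s) :=
  hf.comp (contDiff_prodMk_right s)

theorem deriv_partial_comm (hf : ContDiff ℝ 2 fun p : ℝ × ℝ => f p.1 p.2) (s t : ℝ) :
    deriv (fun σ => deriv (f σ) t) s = deriv (fun y => deriv (fun σ => f σ y) s) t := by
  set F : ℝ × ℝ → E := fun p => f p.1 p.2
  have hd : Differentiable ℝ F := hf.differentiable two_ne_zero
  have hdd : DifferentiableAt ℝ (fderiv ℝ F) (s, t) :=
    (hf.fderiv_right (m := 1) le_rfl).differentiable one_ne_zero _
  have happly (v : ℝ × ℝ) : HasFDerivAt (fun p => fderiv ℝ F p v)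
      ((fderiv ℝ (fderiv ℝ F) (s, t)).flip v) (s, t) := by
    simpa using hdd.hasFDerivAt.clm_apply (hasFDerivAt_const v (s, t))
  have hsnd : (fun σ => deriv (f σ) t) = fun σ => fderiv ℝ F (σ, t) (0, 1) :=
    funext fun σ => (hasDerivAt_partial_snd (hd (σ, t))).deriv
  have hfst : (fun y => deriv (fun σ => f σ y) s) = fun y => fderiv ℝ F (s, y) (1, 0) :=
    funext fun y => (hasDerivAt_partial_fst (hd (s, y))).deriv
  rw [hsnd, hfst,
    (hasDerivAt_partial_fst (f := fun σ y => fderiv ℝ F (σ, y) (0, 1))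
      (happly (0, 1)).differentiableAt).deriv,
    (hasDerivAt_partial_snd (f := fun σ y => fderiv ℝ F (σ, y) (1, 0))
      (happly (1, 0)).differentiableAt).deriv, (happly (0, 1)).fderiv, (happly (1, 0)).fderiv]
  exact hf.contDiffAt.isSymmSndFDerivAt (by simp) _ _

theorem hasDerivAt_integral_of_contDiff (hf : ContDiff ℝ 1 fun p : ℝ × ℝ => f p.1 p.2)
    (a b s : ℝ) :
    HasDerivAt (fun σ => ∫ t in a..b, f σ t) (∫ t in a..b, deriv (fun σ => f σ t) s) s := by
  have hf' := (contDiff_partial_fst hf (m := 0) (by simp)).continuous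
  obtain ⟨C, hC⟩ := ((isCompact_Icc (a := s - 1) (b := s + 1)).prod
    (isCompact_uIcc (a := a) (b := b))).exists_bound_of_continuousOn hf'.continuousOn
  refine (intervalIntegral.hasDerivAt_integral_of_dominated_loc_of_deriv_le
    (F := f) (F' := fun s t => deriv (fun σ => f σ t) s)
    (bound := fun _ => C) (Icc_mem_nhds (sub_one_lt s) (lt_add_one s))
    (.of_forall fun σ => (contDiff_slice_snd hf σ).continuous.aestronglyMeasurable)
    ((contDiff_slice_snd hf s).continuous.intervalIntegrable _ _)
    (hf'.comp (Continuous.prodMk_right s)).aestronglyMeasurable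
    (.of_forall fun t ht σ hσ => hC (σ, t) ⟨hσ, Set.uIoc_subset_uIcc ht⟩)
    intervalIntegrable_const
    (.of_forall fun t _ σ _ =>
      ((contDiff_slice_fst hf t).differentiable one_ne_zero σ).hasDerivAt)).2

theorem hasDerivAt_deriv_integral_of_contDiff (hf : ContDiff ℝ 2 fun p : ℝ × ℝ => f p.1 p.2)
    (a b s : ℝ) :
    HasDerivAt (deriv fun σ => ∫ t in a..b, f σ t)
      (∫ t in a..b, deriv (deriv fun σ => f σ t) s) s := by
  rw [funext fun σ =>
    (hasDerivAt_integral_of_contDiff (hf.of_le one_le_two) a b σ).deriv]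
  exact hasDerivAt_integral_of_contDiff (contDiff_partial_fst hf (m := 1) le_rfl) a b s

end TwoVariables

section OneVariable

theorem deriv_deriv_nonpos_of_isLocalMax {f : ℝ → ℝ} {x : ℝ} (hf : ContinuousAt f x)
    (hx : IsLocalMax f x) : deriv (deriv f) x ≤ 0 := by
  by_contra! hpos
  have hmin : IsLocalMin f x := isLocalMin_of_deriv_deriv_pos hpos hx.deriv_eq_zero hf
  have hconst : f =ᶠ[nhds x] fun _ => f x := by
    filter_upwards [hx, hmin] with y h1 h2 using le_antisymm h1 h2
  have hzero := hconst.deriv.deriv_eq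
  simp only [deriv_const'] at hzero
  linarith

theorem le_of_deriv_deriv_pos_of_frequently_le {m : ℝ → ℝ} (hm : Continuous m) {C : ℝ}
    (hconvex : ∀ s, C < m s → 0 < deriv (deriv m) s)
    (hbot : ∃ᶠ s in Filter.atBot, m s ≤ C) (htop : ∃ᶠ s in Filter.atTop, m s ≤ C) (s : ℝ) :
    m s ≤ C := by
  by_contra! hs
  obtain ⟨a, has, hma⟩ := Filter.frequently_atBot.1 hbot s
  obtain ⟨b, hsb, hmb⟩ := Filter.frequently_atTop.1 htop s
  obtain ⟨x, hx, hmax⟩ := isCompact_Icc.exists_isMaxOn ⟨s, has, hsb⟩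
    (hm.continuousOn (s := Set.Icc a b))
  have hmx : C < m x := hs.trans_le (hmax ⟨has, hsb⟩)
  have hax : a < x := hx.1.lt_of_ne (by rintro rfl; exact hma.not_gt hmx)
  have hxb : x < b := hx.2.lt_of_ne (by rintro rfl; exact hmb.not_gt hmx)
  exact (hconvex x hmx).not_ge (deriv_deriv_nonpos_of_isLocalMax hm.continuousAt
    (hmax.isLocalMax (Icc_mem_nhds hax hxb)))

theorem exists_deriv_deriv_mul_sq_le {m : ℝ → ℝ} (hm : Differentiable ℝ m)
    (hm' : Differentiable ℝ (deriv m)) {a b : ℝ} (hab : a < b) :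
    ∃ s ∈ Set.Icc a b,
      deriv (deriv m) s * (b - a) ^ 2 ≤ 4 * (m a + m b - 2 * m ((a + b) / 2)) := by
  by_contra! hlt
  set K := 4 * (m a + m b - 2 * m ((a + b) / 2)) / (b - a) ^ 2 with hK
  have hba : 0 < (b - a) ^ 2 := by have := sub_pos.2 hab; positivity
  have hd : deriv (fun s => m s - K / 2 * s ^ 2) = fun s => deriv m s - K * s := funext fun s =>
    (((hm s).hasDerivAt.sub ((hasDerivAt_pow 2 s).const_mul (K / 2))).congr_deriv
      (by push_cast; ring)).deriv
  have hdd (s : ℝ) : deriv (fun s => deriv m s - K * s) s = deriv (deriv m) s - K :=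
    ((hm' s).hasDerivAt.sub (hasDerivAt_const_mul K)).deriv
  have hconvex : StrictConvexOn ℝ (Set.Icc a b) fun s => m s - K / 2 * s ^ 2 := by
    refine strictConvexOn_of_deriv2_pos (convex_Icc a b) (by have := hm.continuous; fun_prop)
      fun s hs => ?_
    rw [Function.iterate_succ, Function.iterate_one, Function.comp_apply, hd, hdd, sub_pos, hK,
      div_lt_iff₀ hba]
    exact hlt s (interior_subset hs)
  have hmid := hconvex.2 (Set.left_mem_Icc.2 hab.le) (Set.right_mem_Icc.2 hab.le) hab.ne
    one_half_pos one_half_pos (add_halves 1)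
  rw [show (1 / 2 : ℝ) • a + (1 / 2 : ℝ) • b = (a + b) / 2 by simp only [smul_eq_mul]; ring]
    at hmid
  have hKba : K * (b - a) ^ 2 = 4 * (m a + m b - 2 * m ((a + b) / 2)) :=
    div_mul_cancel₀ _ hba.ne'
  simp only [smul_eq_mul] at hmid
  nlinarith

theorem norm_le_norm_integral_add_integral_norm_deriv {E : Type*} [NormedAddCommGroup E]
    [NormedSpace ℝ E] [CompleteSpace E] {f f' : ℝ → E} (hf : ∀ t, HasDerivAt f (f' t) t)
    (hf' : Continuous f') {t : ℝ} (ht : t ∈ Set.Icc (0 : ℝ) 1) :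
    ‖f t‖ ≤ ‖∫ y in (0 : ℝ)..1, f y‖ + ∫ y in (0 : ℝ)..1, ‖f' y‖ := by
  have hc : Continuous f := continuous_iff_continuousAt.2 fun t => (hf t).continuousAt
  have hosc : ∀ y ∈ Set.Icc (0 : ℝ) 1, ‖f t - f y‖ ≤ ∫ y in (0 : ℝ)..1, ‖f' y‖ := by
    intro y hy
    rw [← intervalIntegral.integral_eq_sub_of_hasDerivAt (fun x _ => hf x)
      (hf'.intervalIntegrable y t), intervalIntegral.integral_of_le zero_le_one]
    refine intervalIntegral.norm_integral_le_integral_norm_uIoc.trans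
      (MeasureTheory.setIntegral_mono_set hf'.norm.integrableOn_Ioc
        (.of_forall fun _ => norm_nonneg _) (.of_forall fun x hx => ?_))
    exact ⟨(le_min hy.1 ht.1).trans_lt hx.1, hx.2.trans (max_le hy.2 ht.2)⟩
  have hmean : f t = (∫ y in (0 : ℝ)..1, f y) + ∫ y in (0 : ℝ)..1, (f t - f y) := by
    rw [intervalIntegral.integral_sub intervalIntegrable_const (hc.intervalIntegrable _ _)]
    simp
  have hint := intervalIntegral.norm_integral_le_of_norm_le_const (a := 0) (b := 1)
    fun y hy => hosc y (Set.uIcc_of_le (zero_le_one (α := ℝ)) ▸ Set.uIoc_subset_uIcc hy)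
  rw [sub_zero, abs_one, mul_one] at hint
  calc ‖f t‖ = ‖(∫ y in (0 : ℝ)..1, f y) + ∫ y in (0 : ℝ)..1, (f t - f y)‖ := by rw [← hmean]
    _ ≤ ‖∫ y in (0 : ℝ)..1, f y‖ + ∫ y in (0 : ℝ)..1, ‖f' y‖ :=
      (norm_add_le _ _).trans (by gcongr)

end OneVariable

section Cylinder

/-- The Laplacian `∂ₛ²u + ∂ₜ²u` of a function `u` on the cylinder `ℝ × S¹`, the circle being
`ℝ/ℤ`. -/
def cylinderLaplacian (u : ℝ → ℝ → ℝ) (s t : ℝ) : ℝ :=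
  deriv (deriv fun σ => u σ t) s + deriv (deriv (u s)) t

theorem cylinderLaplacian_nonpos_of_isLocalMax {u : ℝ → ℝ → ℝ} {s t : ℝ}
    (hc₁ : ContinuousAt (fun σ => u σ t) s) (hc₂ : ContinuousAt (u s) t)
    (hs : IsLocalMax (fun σ => u σ t) s) (ht : IsLocalMax (u s) t) :
    cylinderLaplacian u s t ≤ 0 :=
  add_nonpos (deriv_deriv_nonpos_of_isLocalMax hc₁ hs) (deriv_deriv_nonpos_of_isLocalMax hc₂ ht)

theorem cylinderLaplacian_sub_mul {u : ℝ → ℝ → ℝ} (hu : ContDiff ℝ 2 fun p : ℝ × ℝ => u p.1 p.2)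
    {φ : ℝ → ℝ} (hφ : ContDiff ℝ 2 φ) (c s t : ℝ) :
    cylinderLaplacian (fun s t => u s t - c * φ s) s t =
      cylinderLaplacian u s t - c * deriv (deriv φ) s := by
  have hus := contDiff_slice_fst hu t
  have hφ' : Differentiable ℝ φ := hφ.differentiable two_ne_zero
  have hfst : (deriv fun σ => u σ t - c * φ σ) =
      fun σ => deriv (fun σ => u σ t) σ - c * deriv φ σ := funext fun σ =>
    ((hus.differentiable two_ne_zero σ).hasDerivAt.sub
      ((hφ' σ).hasDerivAt.const_mul c)).deriv
  have hfst₂ : deriv (fun σ => deriv (fun σ => u σ t) σ - c * deriv φ σ) s =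
      deriv (deriv fun σ => u σ t) s - c * deriv (deriv φ) s :=
    ((hus.differentiable_deriv_two s).hasDerivAt.sub
      ((hφ.differentiable_deriv_two s).hasDerivAt.const_mul c)).deriv
  have hsnd : (deriv fun y => u s y - c * φ s) = deriv (u s) :=
    funext fun y => deriv_sub_const ..
  rw [cylinderLaplacian, hfst, hfst₂, hsnd, cylinderLaplacian]
  ring

theorem exists_max_on_cylinder {v : ℝ → ℝ → ℝ} {a b : ℝ} (hab : a ≤ b)
    (hv : ContinuousOn (fun p : ℝ × ℝ => v p.1 p.2) (Set.Icc a b ×ˢ Set.univ))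
    (hper : ∀ s, Function.Periodic (v s) 1) :
    ∃ s ∈ Set.Icc a b, ∃ t, ∀ σ ∈ Set.Icc a b, ∀ y, v σ y ≤ v s t := by
  obtain ⟨⟨s, t⟩, hst, hmax⟩ := (isCompact_Icc.prod isCompact_Icc).exists_isMaxOn
    (s := Set.Icc a b ×ˢ Set.Icc (0 : ℝ) 1) ⟨(a, 0), ⟨le_rfl, hab⟩, le_rfl, zero_le_one⟩
    (hv.mono (Set.prod_mono_right (Set.subset_univ _)))
  refine ⟨s, hst.1, t, fun σ hσ y => ?_⟩
  obtain ⟨y', hy', hyy'⟩ := (hper σ).exists_mem_Ico₀ zero_lt_one y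
  rw [hyy']
  exact hmax (Set.mk_mem_prod hσ (Set.Ico_subset_Icc_self hy'))

theorem le_mul_of_cylinderLaplacian_ge {u : ℝ → ℝ → ℝ}
    (hu : ContDiff ℝ 2 fun p : ℝ × ℝ => u p.1 p.2) (hper : ∀ s, Function.Periodic (u s) 1)
    {C : ℝ} (hlap : ∀ s t, -C * u s t ≤ cylinderLaplacian u s t)
    {φ : ℝ → ℝ} (hφ : ContDiff ℝ 2 φ) {a b B : ℝ} (hφ_pos : ∀ s ∈ Set.Icc a b, 0 < φ s)
    (hφ_super : ∀ s ∈ Set.Icc a b, deriv (deriv φ) s + C * φ s < 0) (hB : 0 ≤ B)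
    (ha : ∀ t, u a t ≤ B * φ a) (hb : ∀ t, u b t ≤ B * φ b) {s : ℝ} (hs : s ∈ Set.Icc a b)
    (t : ℝ) : u s t ≤ B * φ s := by
  obtain ⟨s₀, hs₀, t₀, hmax⟩ := exists_max_on_cylinder (v := fun s t => u s t / φ s)
    (hs.1.trans hs.2)
    (hu.continuous.continuousOn.div (hφ.continuous.comp continuous_fst).continuousOn
      fun p hp => (hφ_pos p.1 hp.1).ne') fun s t => congrArg (· / φ s) (hper s t)
  set c := u s₀ t₀ / φ s₀
  have hle : ∀ σ ∈ Set.Icc a b, ∀ y, u σ y ≤ c * φ σ := fun σ hσ y =>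
    (div_le_iff₀ (hφ_pos σ hσ)).1 (hmax σ hσ y)
  have heq : u s₀ t₀ = c * φ s₀ := (div_mul_cancel₀ _ (hφ_pos s₀ hs₀).ne').symm
  suffices hcB : c ≤ B from
    (hle s hs t).trans (mul_le_mul_of_nonneg_right hcB (hφ_pos s hs).le)
  by_contra! hBc
  have hne : ∀ σ, (∀ y, u σ y ≤ B * φ σ) → s₀ ≠ σ := by
    rintro σ hσ rfl
    exact hBc.not_ge (le_of_mul_le_mul_right (heq ▸ hσ t₀) (hφ_pos s₀ hs₀))
  have hnhds : Set.Icc a b ∈ nhds s₀ :=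
    Icc_mem_nhds (hs₀.1.lt_of_ne (hne a ha).symm) (hs₀.2.lt_of_ne (hne b hb))
  set w : ℝ → ℝ → ℝ := fun s t => u s t - c * φ s with hw
  have hwle : ∀ σ ∈ Set.Icc a b, ∀ y, w σ y ≤ w s₀ t₀ := fun σ hσ y => by
    simp only [hw, heq, sub_self]
    exact sub_nonpos.2 (hle σ hσ y)
  have hnonpos : cylinderLaplacian w s₀ t₀ ≤ 0 := cylinderLaplacian_nonpos_of_isLocalMax
    ((contDiff_slice_fst hu t₀).continuous.sub (hφ.continuous.const_mul c)).continuousAt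
    ((contDiff_slice_snd hu s₀).continuous.sub continuous_const).continuousAt
    (Filter.mem_of_superset hnhds fun σ hσ => hwle σ hσ t₀) (.of_forall (hwle s₀ hs₀))
  rw [cylinderLaplacian_sub_mul hu hφ] at hnonpos
  have hlap₀ := hlap s₀ t₀
  rw [heq] at hlap₀
  nlinarith [hφ_super s₀ hs₀, hB.trans_lt hBc]

theorem le_two_mul_of_cylinderLaplacian_ge {u : ℝ → ℝ → ℝ}
    (hu : ContDiff ℝ 2 fun p : ℝ × ℝ => u p.1 p.2) (hper : ∀ s, Function.Periodic (u s) 1)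
    {C : ℝ} (hC : 0 ≤ C) (hlap : ∀ s t, -C * u s t ≤ cylinderLaplacian u s t) {s₀ a b B : ℝ}
    (ha : a ∈ Set.Icc (s₀ - 1 / (C + 1)) s₀) (hb : b ∈ Set.Icc s₀ (s₀ + 1 / (C + 1)))
    (hB : 0 ≤ B) (hua : ∀ t, u a t ≤ B) (hub : ∀ t, u b t ≤ B) (t : ℝ) : u s₀ t ≤ 2 * B := by
  set φ : ℝ → ℝ := fun s => 2 - (C + 1) * (s - s₀) ^ 2 with hφ
  have hC1 : 0 < C + 1 := by positivity
  have hφ_one : ∀ s ∈ Set.Icc a b, 1 ≤ φ s := by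
    intro s hs
    have hdist : |s - s₀| ≤ 1 / (C + 1) :=
      abs_le.2 ⟨by linarith [hs.1, ha.1], by linarith [hs.2, hb.2]⟩
    have hsq : (C + 1) * (s - s₀) ^ 2 ≤ 1 := by
      calc (C + 1) * (s - s₀) ^ 2 ≤ (C + 1) * (1 / (C + 1)) ^ 2 := by
            rw [← sq_abs]
            gcongr
        _ = 1 / (C + 1) := by field_simp
        _ ≤ 1 := (div_le_one hC1).2 (le_add_of_nonneg_left hC)
    linarith
  have hφ_two (s : ℝ) : φ s ≤ 2 := sub_le_self _ (by positivity)
  have hφ' : deriv φ = fun s => -(2 * (C + 1)) * (s - s₀) := funext fun s => by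
    refine (((((hasDerivAt_id s).sub_const s₀).pow 2).const_mul (C + 1)).const_sub 2).deriv.trans ?_
    simp only [id]
    ring
  have hφ'' (s : ℝ) : deriv (deriv φ) s = -(2 * (C + 1)) := by
    rw [hφ']
    simp
  have hbarrier := le_mul_of_cylinderLaplacian_ge hu hper hlap (φ := φ) (by fun_prop)
    (fun s hs => zero_lt_one.trans_le (hφ_one s hs))
    (fun s _ => by rw [hφ'']; nlinarith [hφ_two s]) hB
    (fun t => (hua t).trans (le_mul_of_one_le_right hB (hφ_one a ⟨le_rfl, ha.2.trans hb.1⟩)))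
    (fun t => (hub t).trans (le_mul_of_one_le_right hB (hφ_one b ⟨ha.2.trans hb.1, le_rfl⟩)))
    ⟨ha.2, hb.1⟩ t
  simpa [hφ, mul_comm] using hbarrier

theorem le_two_mul_integral_add_of_abs_deriv_le {u D : ℝ → ℝ} (hu : ContDiff ℝ 1 u)
    (hper : Function.Periodic u 1) (hu0 : ∀ t, 0 ≤ u t) (hD : Continuous D)
    (hle : ∀ t, |deriv u t| ≤ u t + D t) (t : ℝ) :
    u t ≤ 2 * (∫ t in (0 : ℝ)..1, u t) + ∫ t in (0 : ℝ)..1, D t := by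
  obtain ⟨y, hy, hty⟩ := hper.exists_mem_Ico₀ zero_lt_one t
  have hu' : Continuous (deriv u) := hu.continuous_deriv le_rfl
  have hvar : ∫ t in (0 : ℝ)..1, ‖deriv u t‖ ≤
      (∫ t in (0 : ℝ)..1, u t) + ∫ t in (0 : ℝ)..1, D t := by
    rw [← intervalIntegral.integral_add (hu.continuous.intervalIntegrable _ _)
      (hD.intervalIntegrable _ _)]
    exact intervalIntegral.integral_mono zero_le_one (hu'.norm.intervalIntegrable _ _)
      ((hu.continuous.add hD).intervalIntegrable _ _) hle
  have hbound := norm_le_norm_integral_add_integral_norm_deriv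
    (fun t => (hu.differentiable one_ne_zero t).hasDerivAt) hu' (Set.Ico_subset_Icc_self hy)
  rw [Real.norm_of_nonneg (hu0 y), Real.norm_of_nonneg
    (intervalIntegral.integral_nonneg zero_le_one fun t _ => hu0 t)] at hbound
  rw [hty]
  linarith

theorem exists_circle_le {u D : ℝ → ℝ → ℝ} {M L : ℝ}
    (hu : ContDiff ℝ 2 fun p : ℝ × ℝ => u p.1 p.2) (hper : ∀ s, Function.Periodic (u s) 1)
    (hu0 : ∀ s t, 0 ≤ u s t) (hD : ∀ s, Continuous (D s))
    (hM : ∀ s, ∫ t in (0 : ℝ)..1, u s t ≤ M)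
    (hmean : ∀ s, 4 * (∫ t in (0 : ℝ)..1, D s t) - L ≤
      deriv (deriv fun σ => ∫ t in (0 : ℝ)..1, u σ t) s)
    (hut : ∀ s t, |deriv (u s) t| ≤ u s t + D s t) {a b : ℝ} (hab : a < b) :
    ∃ s ∈ Set.Icc a b, ∀ t, u s t ≤ 2 * M + (8 * M / (b - a) ^ 2 + L) / 4 := by
  set m : ℝ → ℝ := fun s => ∫ t in (0 : ℝ)..1, u s t
  have hm0 (s : ℝ) : 0 ≤ m s := intervalIntegral.integral_nonneg zero_le_one fun t _ => hu0 s t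
  obtain ⟨s, hs, hm''⟩ := exists_deriv_deriv_mul_sq_le (m := m)
    (fun s => (hasDerivAt_integral_of_contDiff (hu.of_le one_le_two) 0 1 s).differentiableAt)
    (fun s => (hasDerivAt_deriv_integral_of_contDiff hu 0 1 s).differentiableAt) hab
  refine ⟨s, hs, fun t => ?_⟩
  have hm''_le : deriv (deriv m) s ≤ 8 * M / (b - a) ^ 2 := by
    rw [le_div_iff₀ (by have := sub_pos.2 hab; positivity)]
    linarith [hM a, hM b, hm0 ((a + b) / 2)]
  linarith [hM s, hmean s, le_two_mul_integral_add_of_abs_deriv_le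
    ((contDiff_slice_snd hu s).of_le one_le_two) (hper s) (hu0 s) (hD s) (hut s) t]

theorem le_of_integral_le_of_cylinderLaplacian_ge {u D : ℝ → ℝ → ℝ} {M L C : ℝ} (hC : 0 ≤ C)
    (hu : ContDiff ℝ 2 fun p : ℝ × ℝ => u p.1 p.2) (hper : ∀ s, Function.Periodic (u s) 1)
    (hu0 : ∀ s t, 0 ≤ u s t) (hD : ∀ s, Continuous (D s))
    (hM : ∀ s, ∫ t in (0 : ℝ)..1, u s t ≤ M)
    (hlap : ∀ s t, -C * u s t ≤ cylinderLaplacian u s t)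
    (hmean : ∀ s, 4 * (∫ t in (0 : ℝ)..1, D s t) - L ≤
      deriv (deriv fun σ => ∫ t in (0 : ℝ)..1, u σ t) s)
    (hut : ∀ s t, |deriv (u s) t| ≤ u s t + D s t) (s t : ℝ) :
    u s t ≤ 2 * (2 * M + (8 * M * (C + 1) ^ 2 + L) / 4) := by
  have hl : 0 < 1 / (C + 1) := by positivity
  have hgood {a b : ℝ} (hab : b - a = 1 / (C + 1)) : ∃ σ ∈ Set.Icc a b, ∀ y,
      u σ y ≤ 2 * M + (8 * M * (C + 1) ^ 2 + L) / 4 := by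
    have hdiv : 8 * M / (b - a) ^ 2 = 8 * M * (C + 1) ^ 2 := by rw [hab]; field_simp
    exact hdiv ▸ exists_circle_le hu hper hu0 hD hM hmean hut (sub_pos.1 (hab ▸ hl))
  obtain ⟨a, ha, hua⟩ := hgood (sub_sub_cancel s (1 / (C + 1)))
  obtain ⟨b, hb, hub⟩ := hgood (add_sub_cancel_left s (1 / (C + 1)))
  exact le_two_mul_of_cylinderLaplacian_ge hu hper hC hlap ha hb ((hu0 a 0).trans (hua 0)) hua hub t

end Cylinder

section Loops

variable {E : Type*} [NormedAddCommGroup E] [NormedSpace ℝ E] {f : ℝ → E}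

theorem IsSmoothLoop.continuous (hf : IsSmoothLoop f) : Continuous f := hf.1.continuous

theorem IsSmoothLoop.hasDerivAt (hf : IsSmoothLoop f) (t : ℝ) :
    HasDerivAt f (deriv f t) t :=
  (hf.1.differentiable (by simp) t).hasDerivAt

theorem periodic_deriv {c : ℝ} (hf : Function.Periodic f c) : Function.Periodic (deriv f) c :=
  fun t => by rw [← deriv_comp_add_const, show (fun x => f (x + c)) = f from funext hf]

theorem IsSmoothLoop.deriv (hf : IsSmoothLoop f) : IsSmoothLoop (deriv f) :=
  ⟨(contDiff_infty_iff_deriv.1 hf.1).2, periodic_deriv hf.2⟩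

theorem IsSmoothLoop.sub {g : ℝ → E} (hf : IsSmoothLoop f) (hg : IsSmoothLoop g) :
    IsSmoothLoop (f - g) :=
  ⟨hf.1.sub hg.1, hf.2.sub hg.2⟩

theorem IsSmoothLoop.const_smul (hf : IsSmoothLoop f) (c : ℝ) : IsSmoothLoop (c • f) :=
  ⟨hf.1.const_smul c, fun t => congrArg (c • ·) (hf.2 t)⟩

theorem integral_eq_zero_of_periodic [CompleteSpace E] {f' : ℝ → E}
    (hf : ∀ t, HasDerivAt f (f' t) t) (hf' : Continuous f') (hper : Function.Periodic f 1) :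
    ∫ t in (0 : ℝ)..1, f' t = 0 := by
  rw [intervalIntegral.integral_eq_sub_of_hasDerivAt (fun t _ => hf t)
    (hf'.intervalIntegrable 0 1), hper.eq, sub_self]

/-- The primitive of `f` whose mean over the unit interval vanishes. It solves `∂ₜξ = f` in the Lie
algebra of normalized gauge transformations. -/
def meanZeroPrimitive (f : ℝ → E) (t : ℝ) : E :=
  (∫ y in (0 : ℝ)..t, f y) - ∫ x in (0 : ℝ)..1, ∫ y in (0 : ℝ)..x, f y

theorem hasDerivAt_meanZeroPrimitive [CompleteSpace E] (hf : Continuous f) (t : ℝ) :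
    HasDerivAt (meanZeroPrimitive f) (f t) t :=
  (hf.integral_hasStrictDerivAt 0 t).hasDerivAt.sub_const _

theorem integral_meanZeroPrimitive [CompleteSpace E] (hf : Continuous f) :
    ∫ t in (0 : ℝ)..1, meanZeroPrimitive f t = 0 := by
  have hc : Continuous fun t => ∫ y in (0 : ℝ)..t, f y :=
    intervalIntegral.continuous_primitive (fun a b => hf.intervalIntegrable a b) 0
  simp only [meanZeroPrimitive]
  rw [intervalIntegral.integral_sub (hc.intervalIntegrable _ _) intervalIntegrable_const]
  simp

theorem IsSmoothLoop.meanZeroPrimitive [CompleteSpace E] (hf : IsSmoothLoop f)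
    (hmean : ∫ t in (0 : ℝ)..1, f t = 0) : IsSmoothLoop (meanZeroPrimitive f) := by
  have hd := hasDerivAt_meanZeroPrimitive hf.continuous
  refine ⟨contDiff_infty_iff_deriv.2 ⟨fun t => (hd t).differentiableAt, ?_⟩, fun t => ?_⟩
  · rw [funext fun t => (hd t).deriv]
    exact hf.1
  · have hperiod : ∫ y in t..t + 1, f y = 0 := by
      rw [hf.2.intervalIntegral_add_eq t 0, zero_add, hmean]
    rw [MomentFloer.meanZeroPrimitive, MomentFloer.meanZeroPrimitive,
      ← intervalIntegral.integral_add_adjacent_intervals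
        (hf.continuous.intervalIntegrable 0 t) (hf.continuous.intervalIntegrable t (t + 1)),
      hperiod, add_zero]

end Loops

section UnitInterval

theorem sq_integral_le_integral_sq {f : ℝ → ℝ} (hf : Continuous f) :
    (∫ t in (0 : ℝ)..1, f t) ^ 2 ≤ ∫ t in (0 : ℝ)..1, f t ^ 2 := by
  simp only [intervalIntegral.integral_of_le zero_le_one]
  have : MeasureTheory.IsProbabilityMeasure
      (MeasureTheory.volume.restrict (Set.Ioc (0 : ℝ) 1)) := ⟨by simp⟩
  exact even_two.convexOn_pow.map_integral_le (continuous_pow 2).continuousOn isClosed_univ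
    (.of_forall fun _ => Set.mem_univ _) hf.integrableOn_Ioc (hf.pow 2).integrableOn_Ioc

theorem norm_sq_le_integral_norm_sq_deriv {E : Type*} [NormedAddCommGroup E] [NormedSpace ℝ E]
    [CompleteSpace E] {f f' : ℝ → E} (hf : ∀ t, HasDerivAt f (f' t) t) (hf' : Continuous f')
    (hmean : ∫ t in (0 : ℝ)..1, f t = 0) {t : ℝ} (ht : t ∈ Set.Icc (0 : ℝ) 1) :
    ‖f t‖ ^ 2 ≤ ∫ y in (0 : ℝ)..1, ‖f' y‖ ^ 2 := by
  have hle := norm_le_norm_integral_add_integral_norm_deriv hf hf' ht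
  rw [hmean, norm_zero, zero_add] at hle
  exact (pow_le_pow_left₀ (norm_nonneg _) hle 2).trans (sq_integral_le_integral_sq hf'.norm)

theorem integral_norm_sq_le_two_mul_add {E : Type*} [NormedAddCommGroup E] {f g : ℝ → E}
    (hf : Continuous f) (hg : Continuous g) :
    ∫ t in (0 : ℝ)..1, ‖f t‖ ^ 2 ≤
      2 * (∫ t in (0 : ℝ)..1, ‖f t - g t‖ ^ 2) + 2 * ∫ t in (0 : ℝ)..1, ‖g t‖ ^ 2 := by
  have hfg : Continuous fun t => 2 * ‖f t - g t‖ ^ 2 := by fun_prop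
  have hg2 : Continuous fun t => 2 * ‖g t‖ ^ 2 := by fun_prop
  rw [← intervalIntegral.integral_const_mul, ← intervalIntegral.integral_const_mul,
    ← intervalIntegral.integral_add (hfg.intervalIntegrable _ _) (hg2.intervalIntegrable _ _)]
  refine intervalIntegral.integral_mono zero_le_one ((hf.norm.pow 2).intervalIntegrable _ _)
    ((hfg.add hg2).intervalIntegrable _ _) fun t => ?_
  have htri := norm_add_le (f t - g t) (g t)
  rw [sub_add_cancel] at htri
  exact ((pow_le_pow_left₀ (norm_nonneg _) htri 2).trans add_sq_le).trans_eq (mul_add _ _ _)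

variable {E : Type*} [NormedAddCommGroup E] [InnerProductSpace ℝ E] [CompleteSpace E] {f : ℝ → E}

theorem integral_inner_const (hf : Continuous f) (c : E) :
    ∫ t in (0 : ℝ)..1, inner ℝ c (f t) = inner ℝ c (∫ t in (0 : ℝ)..1, f t) :=
  (innerSL ℝ c).intervalIntegral_comp_comm (hf.intervalIntegrable 0 1)

theorem integral_norm_const_add_sq (hf : Continuous f) (hmean : ∫ t in (0 : ℝ)..1, f t = 0)
    (c : E) :
    ∫ t in (0 : ℝ)..1, ‖c + f t‖ ^ 2 = ‖c‖ ^ 2 + ∫ t in (0 : ℝ)..1, ‖f t‖ ^ 2 := by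
  simp only [norm_add_sq_real]
  rw [intervalIntegral.integral_add (Continuous.intervalIntegrable (by fun_prop) _ _)
      (Continuous.intervalIntegrable (by fun_prop) _ _),
    intervalIntegral.integral_add intervalIntegrable_const
      (Continuous.intervalIntegrable (by fun_prop) _ _),
    intervalIntegral.integral_const_mul, integral_inner_const hf, hmean]
  simp

end UnitInterval

variable {n k : ℕ}

section LinearAlgebra

variable (A : Matrix (Fin n) (Fin k) ℤ)

/-- The weight of the torus action on the `j`-th coordinate, as a vector: the `j`-th row of `A`. -/
def weightVector (j : Fin n) : TorusLie k :=
  WithLp.toLp 2 fun l => (A j l : ℝ)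

theorem weight_eq_inner (ξ : TorusLie k) (j : Fin n) :
    weight A ξ j = inner ℝ (weightVector A j) ξ := by
  simp [weight, weightVector, PiLp.inner_apply, mul_comm]

theorem abs_weight_le (ξ : TorusLie k) (j : Fin n) :
    |weight A ξ j| ≤ (∑ i, ‖weightVector A i‖) * ‖ξ‖ := by
  rw [weight_eq_inner]
  exact (abs_real_inner_le_norm _ _).trans (mul_le_mul_of_nonneg_right
    (Finset.single_le_sum (f := fun i => ‖weightVector A i‖) (fun i _ => norm_nonneg _)
      (Finset.mem_univ j)) (norm_nonneg _))

theorem inner_momentMap (z : CSpace n) (ξ : TorusLie k) :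
    inner ℝ (momentMap A z) ξ = -(1 / 2) * ∑ j, weight A ξ j * ‖z j‖ ^ 2 := by
  simp only [momentMap, weight, PiLp.inner_apply, RCLike.inner_apply, conj_trivial,
    Finset.mul_sum, Finset.sum_mul]
  rw [Finset.sum_comm]
  exact Finset.sum_congr rfl fun j _ => Finset.sum_congr rfl fun l _ => by ring

theorem norm_momentMap_le (z : CSpace n) :
    ‖momentMap A z‖ ≤ (∑ j, ‖weightVector A j‖) * ‖z‖ ^ 2 := by
  have hsum : momentMap A z = ∑ j, (-(1 / 2 : ℝ) * ‖z j‖ ^ 2) • weightVector A j := by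
    ext l
    simp only [momentMap, weightVector, PiLp.toLp_apply, WithLp.ofLp_sum, Finset.sum_apply,
      WithLp.ofLp_smul, Pi.smul_apply, smul_eq_mul, Finset.mul_sum]
    exact Finset.sum_congr rfl fun j _ => by ring
  rw [hsum, Finset.sum_mul]
  refine norm_sum_le_of_le _ fun j _ => ?_
  rw [norm_smul, mul_comm, Real.norm_eq_abs, abs_mul, abs_of_nonneg (sq_nonneg ‖z j‖)]
  gcongr
  have hcoord : ‖z j‖ ^ 2 ≤ ‖z‖ ^ 2 := pow_le_pow_left₀ (norm_nonneg _) (PiLp.norm_apply_le z j) 2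
  rw [show |-(1 / 2 : ℝ)| = 1 / 2 by norm_num]
  linarith [sq_nonneg ‖z‖]

theorem momentMap_smul (c : ℝ) (z : CSpace n) : momentMap A (c • z) = c ^ 2 • momentMap A z := by
  ext l
  simp only [momentMap, PiLp.smul_apply, norm_smul, mul_pow, Real.norm_eq_abs, sq_abs,
    PiLp.toLp_apply, smul_eq_mul, Finset.mul_sum]
  exact Finset.sum_congr rfl fun j _ => by ring

theorem norm_infAction_le (z : CSpace n) (ξ : TorusLie k) :
    ‖infAction A z ξ‖ ≤ (∑ j, ‖weightVector A j‖) * ‖ξ‖ * ‖z‖ := by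
  refine (sq_le_sq₀ (norm_nonneg _) (by positivity)).1 ?_
  rw [mul_pow, EuclideanSpace.norm_sq_eq, EuclideanSpace.norm_sq_eq z, Finset.mul_sum]
  refine Finset.sum_le_sum fun j _ => ?_
  have hcoord : ‖infAction A z ξ j‖ = |weight A ξ j| * ‖z j‖ := by simp [infAction]
  rw [hcoord, mul_pow]
  gcongr
  exact abs_weight_le A ξ j

theorem contDiff_momentMap {m : WithTop ℕ∞} : ContDiff ℝ m (momentMap A) := by
  refine (contDiff_euclidean (𝕜 := ℝ)).2 fun l => contDiff_const.mul (ContDiff.sum fun j _ =>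
    contDiff_const.mul (ContDiff.norm_sq ℝ ?_))
  fun_prop

theorem contDiff_infAction {F : Type*} [NormedAddCommGroup F] [NormedSpace ℝ F]
    {m : WithTop ℕ∞} {z : F → CSpace n} {ξ : F → TorusLie k} (hz : ContDiff ℝ m z)
    (hξ : ContDiff ℝ m ξ) : ContDiff ℝ m fun x => infAction A (z x) (ξ x) := by
  refine (contDiff_piLp' (p := 2) fun j => ?_)
  simp only [infAction, weight_eq_inner]
  have : ContDiff ℝ m fun x => ((inner ℝ (weightVector A j) (ξ x) : ℝ) : ℂ) :=
    Complex.ofRealCLM.contDiff.comp (contDiff_const.inner ℝ hξ)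
  fun_prop

theorem hasDerivAt_add_smul {E : Type*} [NormedAddCommGroup E] [NormedSpace ℝ E] (a b : E) :
    HasDerivAt (fun ε : ℝ => a + ε • b) b 0 := by
  simpa using ((hasDerivAt_id (0 : ℝ)).smul_const b).const_add a

theorem hasDerivAt_momentMap_add_smul (z w : CSpace n) :
    HasDerivAt (fun ε : ℝ => momentMap A (z + ε • w)) (fderiv ℝ (momentMap A) z w) 0 :=
  ((contDiff_momentMap A (m := 1)).differentiable one_ne_zero z).hasFDerivAt.comp_hasDerivAt_of_eq
    (0 : ℝ) (hasDerivAt_add_smul z w) (by simp)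

theorem inner_fderiv_momentMap (z w : CSpace n) (ξ : TorusLie k) :
    inner ℝ (fderiv ℝ (momentMap A) z w) ξ = symplecticForm (infAction A z ξ) w := by
  have hderiv := (hasDerivAt_momentMap_add_smul A z w).inner ℝ (hasDerivAt_const 0 ξ)
  simp only [inner_zero_right, zero_add] at hderiv
  exact hderiv.unique (hasDerivAt_inner_momentMap A ξ z w)

end LinearAlgebra

section SymplecticForm

theorem re_inner_I_smul (v w : CSpace n) :
    (inner ℂ (Complex.I • v) w).re = symplecticForm v w := by
  simp only [symplecticForm, PiLp.inner_apply, RCLike.inner_apply, Complex.re_sum]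
  exact Finset.sum_congr rfl fun j _ => by
    simp only [PiLp.smul_apply, smul_eq_mul, map_mul, Complex.conj_I, neg_mul, mul_neg,
      Complex.neg_re, Complex.mul_re, Complex.I_re, Complex.conj_re, zero_mul, Complex.I_im,
      Complex.conj_im, one_mul, sub_neg_eq_add, zero_add, Complex.mul_im, neg_zero, neg_sub]
    ring

theorem symplecticForm_add_left (u v w : CSpace n) :
    symplecticForm (u + v) w = symplecticForm u w + symplecticForm v w := by
  simp only [symplecticForm, ← Finset.sum_add_distrib]
  exact Finset.sum_congr rfl fun j _ => by
    simp only [PiLp.add_apply, Complex.add_re, Complex.add_im]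
    ring

theorem symplecticForm_swap (v w : CSpace n) : symplecticForm v w = -symplecticForm w v := by
  simp only [symplecticForm, ← Finset.sum_neg_distrib]
  exact Finset.sum_congr rfl fun j _ => by ring

theorem symplecticForm_infAction (A : Matrix (Fin n) (Fin k) ℤ) (z : CSpace n)
    (ξ ζ : TorusLie k) : symplecticForm (infAction A z ξ) (infAction A z ζ) = 0 :=
  Finset.sum_eq_zero fun j _ => by
    simp only [infAction, Complex.mul_re, Complex.I_re, Complex.ofReal_re, zero_mul,
      Complex.I_im, Complex.ofReal_im, mul_zero, sub_self, Complex.mul_im, one_mul, zero_add,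
      zero_sub, neg_mul, mul_neg, sub_neg_eq_add]
    ring

/-- The Liouville form `λ = ∑ yⱼ dxⱼ` at `z = x + iy`, applied to the tangent vector `v`. -/
def liouvilleForm (z v : CSpace n) : ℝ :=
  ∑ j, (z j).im * (v j).re

theorem liouvilleForm_add_liouvilleForm_swap (z w z' w' : CSpace n) :
    liouvilleForm w z' + liouvilleForm z w' =
      symplecticForm z' w + (liouvilleForm z' w + liouvilleForm z w') := by
  simp only [liouvilleForm, symplecticForm, ← Finset.sum_add_distrib]
  exact Finset.sum_congr rfl fun j _ => by ring

theorem contDiff_liouvilleForm {F : Type*} [NormedAddCommGroup F] [NormedSpace ℝ F]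
    {m : WithTop ℕ∞} {z v : F → CSpace n} (hz : ContDiff ℝ m z) (hv : ContDiff ℝ m v) :
    ContDiff ℝ m fun x => liouvilleForm (z x) (v x) :=
  ContDiff.sum fun j _ =>
    (Complex.imCLM.contDiff.comp (by fun_prop : ContDiff ℝ m fun x => z x j)).mul
      (Complex.reCLM.contDiff.comp (by fun_prop : ContDiff ℝ m fun x => v x j))

theorem hasDerivAt_apply {z : ℝ → CSpace n} {z' : CSpace n} {t : ℝ} (hz : HasDerivAt z z' t)
    (j : Fin n) : HasDerivAt (fun t => z t j) (z' j) t :=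
  (PiLp.proj (𝕜 := ℝ) 2 (fun _ : Fin n => ℂ) j).hasFDerivAt.comp_hasDerivAt t hz

theorem hasDerivAt_liouvilleForm {z v : ℝ → CSpace n} {z' v' : CSpace n} {t : ℝ}
    (hz : HasDerivAt z z' t) (hv : HasDerivAt v v' t) :
    HasDerivAt (fun t => liouvilleForm (z t) (v t))
      (liouvilleForm z' (v t) + liouvilleForm (z t) v') t := by
  simp only [liouvilleForm, ← Finset.sum_add_distrib]
  exact HasDerivAt.fun_sum fun j _ =>
    (Complex.imCLM.hasFDerivAt.comp_hasDerivAt t (hasDerivAt_apply hz j)).mul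
      (Complex.reCLM.hasFDerivAt.comp_hasDerivAt t (hasDerivAt_apply hv j))

end SymplecticForm

section FirstVariation

variable {A : Matrix (Fin n) (Fin k) ℤ} {τ η v : TorusLie k} {z w : ℝ → CSpace n}

/-- The covariant derivative `∂ₜz + L_z η` of the loop `z` with respect to the constant
connection `η`, the loop part of the differential of the action. -/
def covariantDeriv (A : Matrix (Fin n) (Fin k) ℤ) (z : ℝ → CSpace n) (η : TorusLie k) (t : ℝ) :
    CSpace n :=
  deriv z t + infAction A (z t) η

theorem IsSmoothLoop.continuous_covariantDeriv (hz : IsSmoothLoop z) :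
    Continuous (covariantDeriv A z η) :=
  hz.deriv.continuous.add (contDiff_infAction A hz.1 contDiff_const).continuous

theorem continuous_symplecticForm (hz : Continuous z) (hw : Continuous w) :
    Continuous fun t => symplecticForm (z t) (w t) := by
  unfold symplecticForm
  fun_prop

theorem contDiff_add_smul {E : Type*} [NormedAddCommGroup E] [NormedSpace ℝ E] {f g : ℝ → E}
    {m : WithTop ℕ∞} (hf : ContDiff ℝ m f) (hg : ContDiff ℝ m g) :
    ContDiff ℝ m fun p : ℝ × ℝ => f p.2 + p.1 • g p.2 :=
  (hf.comp contDiff_snd).add (contDiff_fst.smul (hg.comp contDiff_snd))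

theorem deriv_liouvilleForm_add_smul (z w z' w' : CSpace n) :
    deriv (fun ε : ℝ => liouvilleForm (z + ε • w) (z' + ε • w')) 0 =
      symplecticForm z' w + (liouvilleForm z' w + liouvilleForm z w') := by
  have h := (hasDerivAt_liouvilleForm (hasDerivAt_add_smul z w) (hasDerivAt_add_smul z' w')).deriv
  simp only [zero_smul, add_zero] at h
  exact h.trans (liouvilleForm_add_liouvilleForm_swap z w z' w')

theorem hasDerivAt_integral_liouvilleForm (hz : IsSmoothLoop z) (hw : IsSmoothLoop w) :
    HasDerivAt (fun ε : ℝ =>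
        ∫ t in (0 : ℝ)..1, liouvilleForm (z t + ε • w t) (deriv z t + ε • deriv w t))
      (∫ t in (0 : ℝ)..1, symplecticForm (deriv z t) (w t)) 0 := by
  have hexact : Continuous fun t =>
      liouvilleForm (deriv z t) (w t) + liouvilleForm (z t) (deriv w t) :=
    (contDiff_liouvilleForm hz.deriv.1 hw.1).continuous.add
      (contDiff_liouvilleForm hz.1 hw.deriv.1).continuous
  have hperiod : ∫ t in (0 : ℝ)..1,
      (liouvilleForm (deriv z t) (w t) + liouvilleForm (z t) (deriv w t)) = 0 :=
    integral_eq_zero_of_periodic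
      (fun t => hasDerivAt_liouvilleForm (hz.hasDerivAt t) (hw.hasDerivAt t)) hexact
      fun t => by simp only [hz.2 t, hw.2 t]
  refine (hasDerivAt_integral_of_contDiff
    (f := fun ε t => liouvilleForm (z t + ε • w t) (deriv z t + ε • deriv w t))
    (contDiff_liouvilleForm (contDiff_add_smul (hz.1.of_le (by simp)) (hw.1.of_le (by simp)))
      (contDiff_add_smul (hz.deriv.1.of_le (by simp)) (hw.deriv.1.of_le (by simp))))
    0 1 0).congr_deriv ?_
  simp only [deriv_liouvilleForm_add_smul]
  rw [intervalIntegral.integral_add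
    ((continuous_symplecticForm hz.deriv.continuous hw.continuous).intervalIntegrable _ _)
    (hexact.intervalIntegrable _ _), hperiod, add_zero]

theorem deriv_inner_momentMap_add_smul (z w : CSpace n) :
    deriv (fun ε : ℝ => inner ℝ (momentMap A (z + ε • w) - τ) (η + ε • v)) 0 =
      symplecticForm (infAction A z η) w + inner ℝ (momentMap A z - τ) v := by
  rw [(((hasDerivAt_momentMap_add_smul A z w).sub_const τ).inner ℝ
    (hasDerivAt_add_smul η v)).deriv, zero_smul, zero_smul, add_zero, add_zero,
    inner_fderiv_momentMap, add_comm]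

theorem hasDerivAt_integral_inner_momentMap (hz : ContDiff ℝ 1 z) (hw : ContDiff ℝ 1 w) :
    HasDerivAt (fun ε : ℝ =>
        ∫ t in (0 : ℝ)..1, inner ℝ (momentMap A (z t + ε • w t) - τ) (η + ε • v))
      (∫ t in (0 : ℝ)..1,
        (symplecticForm (infAction A (z t) η) (w t) + inner ℝ (momentMap A (z t) - τ) v)) 0 := by
  have hη : ContDiff ℝ 1 fun p : ℝ × ℝ => η + p.1 • v :=
    contDiff_const.add (contDiff_fst.smul contDiff_const)
  have hderiv := hasDerivAt_integral_of_contDiff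
    (f := fun ε t => inner ℝ (momentMap A (z t + ε • w t) - τ) (η + ε • v))
    ((((contDiff_momentMap A).comp (contDiff_add_smul hz hw)).sub contDiff_const).inner ℝ hη) 0 1 0
  simpa only [deriv_inner_momentMap_add_smul] using hderiv

theorem hasDerivAt_action₀ (hz : IsSmoothLoop z) {w : (ℝ → CSpace n) × TorusLie k}
    (hw : IsSmoothLoop w.1) :
    HasDerivAt (fun ε : ℝ => action₀ A τ ((z, η) + ε • w))
      (l2Metric (fun t => Complex.I • covariantDeriv A z η t, fun t => momentMap A (z t) - τ)
        (incl w)) 0 := by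
  have hderiv (ε t : ℝ) : deriv (z + ε • w.1) t = deriv z t + ε • deriv w.1 t :=
    ((hz.hasDerivAt t).add ((hw.hasDerivAt t).const_smul ε)).deriv
  have haction : (fun ε : ℝ => action₀ A τ ((z, η) + ε • w)) = fun ε =>
      (∫ t in (0 : ℝ)..1, liouvilleForm (z t + ε • w.1 t) (deriv z t + ε • deriv w.1 t)) +
        ∫ t in (0 : ℝ)..1, inner ℝ (momentMap A (z t + ε • w.1 t) - τ) (η + ε • w.2) := by
    funext ε
    simp only [action₀, action, incl, Prod.fst_add, Prod.snd_add, Prod.smul_fst, Prod.smul_snd,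
      hderiv, liouvilleForm, Pi.add_apply, Pi.smul_apply]
  rw [haction]
  refine ((hasDerivAt_integral_liouvilleForm hz hw).add (hasDerivAt_integral_inner_momentMap
    (hz.1.of_le (by simp)) (hw.1.of_le (by simp)))).congr_deriv ?_
  have hμ : Continuous fun t => momentMap A (z t) - τ :=
    ((contDiff_momentMap A (m := 0)).continuous.comp hz.continuous).sub continuous_const
  have hpot : Continuous fun t => symplecticForm (infAction A (z t) η) (w.1 t) +
      inner ℝ (momentMap A (z t) - τ) w.2 :=
    (continuous_symplecticForm (contDiff_infAction A hz.1 contDiff_const).continuous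
      hw.continuous).add (hμ.inner continuous_const)
  rw [← intervalIntegral.integral_add
    ((continuous_symplecticForm hz.deriv.continuous hw.continuous).intervalIntegrable _ _)
    (hpot.intervalIntegrable _ _), l2Metric]
  refine intervalIntegral.integral_congr fun t _ => ?_
  simp only [incl, covariantDeriv, re_inner_I_smul, symplecticForm_add_left]
  ring

end FirstVariation

section HorizontalGradient

variable {A : Matrix (Fin n) (Fin k) ℤ} {τ η : TorusLie k} {r : ℝ} {z : ℝ → CSpace n}

theorem continuous_momentMap_comp {X : Type*} [TopologicalSpace X] {z : X → CSpace n}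
    (hz : Continuous z) : Continuous fun x => momentMap A (z x) :=
  (contDiff_momentMap A (m := 0)).continuous.comp hz

theorem integral_momentMap_sub_meanMoment (hz : Continuous z) :
    ∫ t in (0 : ℝ)..1, (momentMap A (z t) - meanMoment A z) = 0 := by
  rw [intervalIntegral.integral_sub ((continuous_momentMap_comp hz).intervalIntegrable _ _)
    intervalIntegrable_const, intervalIntegral.integral_const, sub_zero, one_smul, meanMoment,
    sub_self]

theorem l2Metric_incl {v : (ℝ → CSpace n) × (ℝ → TorusLie k)} {w : (ℝ → CSpace n) × TorusLie k}
    (hv₁ : Continuous v.1) (hv₂ : Continuous v.2) (hw : Continuous w.1) :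
    l2Metric v (incl w) = (∫ t in (0 : ℝ)..1, (inner ℂ (v.1 t) (w.1 t)).re) +
      inner ℝ (∫ t in (0 : ℝ)..1, v.2 t) w.2 := by
  rw [l2Metric, real_inner_comm, ← integral_inner_const hv₂]
  simp only [incl, real_inner_comm w.2]
  exact intervalIntegral.integral_add
    ((Complex.continuous_re.comp (hv₁.inner hw)).intervalIntegrable _ _)
    ((continuous_const.inner hv₂).intervalIntegrable _ _)

/-- The horizontal lift, at the point `(z, η)` of `ℒ₀ ⊂ ℒ`, of the gradient of `𝒜₀` with respect
to the quotient metric `g_r`. -/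
def horizontalGradient (A : Matrix (Fin n) (Fin k) ℤ) (τ : TorusLie k) (r : ℝ)
    (z : ℝ → CSpace n) (η : TorusLie k) : (ℝ → CSpace n) × (ℝ → TorusLie k) :=
  (fun t => Complex.I • covariantDeriv A z η t,
    fun t => (meanMoment A z - τ) + r • (momentMap A (z t) - meanMoment A z))

theorem continuous_horizontalGradient (hz : IsSmoothLoop z) :
    Continuous (horizontalGradient A τ r z η).1 ∧ Continuous (horizontalGradient A τ r z η).2 :=
  ⟨hz.continuous_covariantDeriv.fun_const_smul _, continuous_const.fun_add
    (((continuous_momentMap_comp hz.continuous).fun_sub continuous_const).fun_const_smul r)⟩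

theorem hasDerivAt_action₀_horizontalGradient (hz : IsSmoothLoop z)
    {w : (ℝ → CSpace n) × TorusLie k} (hw : IsSmoothLoop w.1) :
    HasDerivAt (fun ε : ℝ => action₀ A τ ((z, η) + ε • w))
      (l2Metric (horizontalGradient A τ r z η) (incl w)) 0 := by
  have hμ : Continuous fun t => momentMap A (z t) := continuous_momentMap_comp hz.continuous
  have hmean : ∫ t in (0 : ℝ)..1, (horizontalGradient A τ r z η).2 t =
      ∫ t in (0 : ℝ)..1, (momentMap A (z t) - τ) := by
    simp only [horizontalGradient]
    rw [intervalIntegral.integral_add intervalIntegrable_const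
        (((hμ.fun_sub continuous_const).fun_const_smul r).intervalIntegrable _ _),
      intervalIntegral.integral_smul, integral_momentMap_sub_meanMoment hz.continuous,
      intervalIntegral.integral_sub (hμ.intervalIntegrable _ _) intervalIntegrable_const,
      intervalIntegral.integral_const, intervalIntegral.integral_const, meanMoment]
    simp only [sub_zero, one_smul, smul_zero, add_zero]
  convert hasDerivAt_action₀ (A := A) (τ := τ) (η := η) hz hw using 1
  rw [l2Metric_incl (continuous_horizontalGradient hz).1 (continuous_horizontalGradient hz).2
      hw.continuous,
    l2Metric_incl (hz.continuous_covariantDeriv.fun_const_smul _) (hμ.fun_sub continuous_const)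
      hw.continuous, hmean]
  rfl

theorem l2Metric_horizontalGradient_infGauge (hr : r ≠ 0) (hz : IsSmoothLoop z)
    {χ : ℝ → TorusLie k} (hχ : χ ∈ lieGauge k) :
    l2Metric (horizontalGradient A τ r z η) (infGauge A r z χ) = 0 := by
  set c : TorusLie k := (1 / r) • (meanMoment A z - τ) - meanMoment A z with hc
  have hμ (t : ℝ) : HasDerivAt (fun t => momentMap A (z t) + c)
      (fderiv ℝ (momentMap A) (z t) (deriv z t)) t :=
    (((contDiff_momentMap A (m := 1)).differentiable one_ne_zero
      (z t)).hasFDerivAt.comp_hasDerivAt t (hz.hasDerivAt t)).add_const c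
  have hcont : Continuous fun t => inner ℝ (momentMap A (z t) + c) (deriv χ t) +
      symplecticForm (infAction A (z t) (χ t)) (deriv z t) :=
    (((continuous_momentMap_comp hz.continuous).add continuous_const).inner
      hχ.1.deriv.continuous).add
      (continuous_symplecticForm (contDiff_infAction A hz.1 hχ.1.1).continuous hz.deriv.continuous)
  have hderiv (t : ℝ) : HasDerivAt (fun t => inner ℝ (momentMap A (z t) + c) (χ t))
      (inner ℝ (momentMap A (z t) + c) (deriv χ t) +
        symplecticForm (infAction A (z t) (χ t)) (deriv z t)) t :=
    ((hμ t).inner ℝ (hχ.1.hasDerivAt t)).congr_deriv (by rw [inner_fderiv_momentMap])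
  have hperiod := integral_eq_zero_of_periodic hderiv hcont
    fun t => by simp only [hz.2 t, hχ.1.2 t]
  refine neg_eq_zero.1 (Eq.trans ?_ hperiod)
  rw [l2Metric, ← intervalIntegral.integral_neg]
  refine intervalIntegral.integral_congr fun t _ => ?_
  simp only [horizontalGradient, infGauge, covariantDeriv, re_inner_I_smul,
    symplecticForm_add_left, symplecticForm_infAction, symplecticForm_swap (deriv z t)]
  simp only [hc, inner_add_left, inner_sub_left, inner_neg_right, real_inner_smul_left,
    real_inner_smul_right]
  field_simp
  ring

end HorizontalGradient

section QuotientMetric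

variable {A : Matrix (Fin n) (Fin k) ℤ} {τ η : TorusLie k} {r : ℝ} {z : ℝ → CSpace n}

theorem quotientLengthSq_le {χ : ℝ → TorusLie k} (hχ : χ ∈ lieGauge k)
    (v : (ℝ → CSpace n) × (ℝ → TorusLie k)) :
    quotientLengthSq A r z v ≤ l2Metric (v - infGauge A r z χ) (v - infGauge A r z χ) :=
  csInf_le ⟨0, by rintro _ ⟨ξ, -, rfl⟩; exact l2Metric_self_nonneg _⟩ ⟨χ, hχ, rfl⟩

theorem zero_mem_lieGauge : (0 : ℝ → TorusLie k) ∈ lieGauge k :=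
  ⟨⟨contDiff_const, fun _ => rfl⟩, by simp⟩

theorem le_quotientLengthSq {v : (ℝ → CSpace n) × (ℝ → TorusLie k)} {c : ℝ}
    (hc : ∀ χ ∈ lieGauge k, c ≤ l2Metric (v - infGauge A r z χ) (v - infGauge A r z χ)) :
    c ≤ quotientLengthSq A r z v :=
  le_csInf ⟨_, 0, zero_mem_lieGauge, rfl⟩ (by rintro _ ⟨χ, hχ, rfl⟩; exact hc χ hχ)

theorem l2Metric_add_self {u v : (ℝ → CSpace n) × (ℝ → TorusLie k)}
    (hu : Continuous u.1 ∧ Continuous u.2) (hv : Continuous v.1 ∧ Continuous v.2) :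
    l2Metric (u + v) (u + v) = l2Metric u u + 2 * l2Metric u v + l2Metric v v := by
  have huv : Continuous (u + v).1 ∧ Continuous (u + v).2 := ⟨hu.1.add hv.1, hu.2.add hv.2⟩
  rw [l2Metric_add_left hu hv huv, l2Metric_comm u (u + v), l2Metric_comm v (u + v),
    l2Metric_add_left hu hv hu, l2Metric_add_left hu hv hv, l2Metric_comm v u]
  ring

theorem le_quotientLengthSq_horizontal_add (hz : IsSmoothLoop z)
    {h u : (ℝ → CSpace n) × (ℝ → TorusLie k)} (hh : Continuous h.1 ∧ Continuous h.2)
    (hu : Continuous u.1 ∧ Continuous u.2) {ξ : ℝ → TorusLie k} (hξ : ξ ∈ lieGauge k)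
    (hor : ∀ χ ∈ lieGauge k, l2Metric h (infGauge A r z χ) = 0) :
    l2Metric h h + 2 * l2Metric h u + quotientLengthSq A r z u ≤
      quotientLengthSq A r z (h + infGauge A r z ξ + u) := by
  refine le_quotientLengthSq fun χ hχ => ?_
  have hξχ := lieGauge_add hξ (lieGauge_neg hχ)
  have hg := continuous_infGauge A r hz hξχ
  have hgu : Continuous (infGauge A r z (ξ + -χ) + u).1 ∧
      Continuous (infGauge A r z (ξ + -χ) + u).2 := ⟨hg.1.add hu.1, hg.2.add hu.2⟩
  have hle := quotientLengthSq_le (A := A) (r := r) (z := z) (lieGauge_add hχ (lieGauge_neg hξ)) u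
  have hu_sub : u - infGauge A r z (χ + -ξ) = infGauge A r z (ξ + -χ) + u := by
    rw [infGauge_add A r z hχ (lieGauge_neg hξ), infGauge_add A r z hξ (lieGauge_neg hχ),
      infGauge_neg, infGauge_neg]
    abel
  have hsplit : h + infGauge A r z ξ + u - infGauge A r z χ =
      h + (infGauge A r z (ξ + -χ) + u) := by
    rw [infGauge_add A r z hξ (lieGauge_neg hχ), infGauge_neg]
    abel
  rw [hu_sub] at hle
  rw [hsplit, l2Metric_add_self hh hgu, l2Metric_comm h (_ + u), l2Metric_add_left hg hu hh,
    l2Metric_comm (infGauge A r z _) h, hor _ hξχ, l2Metric_comm u h]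
  linarith

theorem l2Metric_self_eq {v : (ℝ → CSpace n) × (ℝ → TorusLie k)} (hv₁ : Continuous v.1)
    (hv₂ : Continuous v.2) :
    l2Metric v v = (∫ t in (0 : ℝ)..1, ‖v.1 t‖ ^ 2) + ∫ t in (0 : ℝ)..1, ‖v.2 t‖ ^ 2 := by
  rw [← intervalIntegral.integral_add ((hv₁.norm.fun_pow 2).intervalIntegrable _ _)
      ((hv₂.norm.fun_pow 2).intervalIntegrable _ _)]
  refine intervalIntegral.integral_congr fun t _ => ?_
  rw [real_inner_self_eq_norm_sq, ← inner_self_eq_norm_sq (𝕜 := ℂ) (v.1 t)]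
  rfl

theorem l2Metric_incl_self {w : (ℝ → CSpace n) × TorusLie k} (hw : Continuous w.1) :
    l2Metric (incl w) (incl w) = (∫ t in (0 : ℝ)..1, ‖w.1 t‖ ^ 2) + ‖w.2‖ ^ 2 := by
  rw [l2Metric_self_eq (v := incl w) hw continuous_const]
  simp [incl]

theorem l2Metric_incl_sub_infGauge (hz : IsSmoothLoop z) {w : (ℝ → CSpace n) × TorusLie k}
    (hw : Continuous w.1) {χ : ℝ → TorusLie k} (hχ : χ ∈ lieGauge k) :
    l2Metric (incl w - infGauge A r z χ) (incl w - infGauge A r z χ) =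
      (∫ t in (0 : ℝ)..1, ‖w.1 t - infAction A (z t) (χ t)‖ ^ 2) + ‖w.2‖ ^ 2 +
        (1 / r) ^ 2 * ∫ t in (0 : ℝ)..1, ‖deriv χ t‖ ^ 2 := by
  have hG := continuous_infGauge A r hz hχ
  have hperiod : ∫ t in (0 : ℝ)..1, (1 / r) • deriv χ t = 0 := by
    rw [intervalIntegral.integral_smul,
      integral_eq_zero_of_periodic hχ.1.hasDerivAt hχ.1.deriv.continuous hχ.1.2, smul_zero]
  rw [l2Metric_self_eq (hw.sub hG.1) (continuous_const.sub hG.2), add_assoc]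
  congr 1
  simp only [incl, infGauge, Prod.snd_sub, Pi.sub_apply, sub_neg_eq_add]
  rw [integral_norm_const_add_sq (hχ.1.deriv.continuous.fun_const_smul _) hperiod]
  simp only [norm_smul, mul_pow, Real.norm_eq_abs, sq_abs, intervalIntegral.integral_const_mul]

theorem integral_norm_sq_infAction_le (hz : IsSmoothLoop z) {χ : ℝ → TorusLie k}
    (hχ : χ ∈ lieGauge k) {R : ℝ} (hR : ∀ t ∈ Set.Icc (0 : ℝ) 1, ‖z t‖ ≤ R) :
    ∫ t in (0 : ℝ)..1, ‖infAction A (z t) (χ t)‖ ^ 2 ≤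
      ((∑ j, ‖weightVector A j‖) * R) ^ 2 * ∫ t in (0 : ℝ)..1, ‖deriv χ t‖ ^ 2 := by
  have hpoint (t : ℝ) (ht : t ∈ Set.Icc (0 : ℝ) 1) : ‖infAction A (z t) (χ t)‖ ^ 2 ≤
      ((∑ j, ‖weightVector A j‖) * R) ^ 2 * ∫ t in (0 : ℝ)..1, ‖deriv χ t‖ ^ 2 := by
    refine (pow_le_pow_left₀ (norm_nonneg _) (norm_infAction_le A (z t) (χ t)) 2).trans ?_
    rw [mul_right_comm, mul_pow]
    have hz_le : (∑ j, ‖weightVector A j‖) * ‖z t‖ ≤ (∑ j, ‖weightVector A j‖) * R :=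
      mul_le_mul_of_nonneg_left (hR t ht) (Finset.sum_nonneg fun _ _ => norm_nonneg _)
    have hχ_le := norm_sq_le_integral_norm_sq_deriv hχ.1.hasDerivAt hχ.1.deriv.continuous hχ.2 ht
    gcongr
  have hL := (contDiff_infAction A hz.1 hχ.1.1).continuous
  simpa using intervalIntegral.integral_mono_on (μ := MeasureTheory.volume) zero_le_one
    ((hL.norm.fun_pow 2).intervalIntegrable _ _) intervalIntegrable_const hpoint

theorem exists_l2Metric_incl_self_le (A : Matrix (Fin n) (Fin k) ℤ) (hr : r ≠ 0)
    (hz : IsSmoothLoop z) :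
    ∃ K, ∀ w : (ℝ → CSpace n) × TorusLie k, Continuous w.1 →
      l2Metric (incl w) (incl w) ≤ K * quotientLengthSq A r z (incl w) := by
  obtain ⟨R, hR⟩ := isCompact_Icc.exists_bound_of_continuousOn
    (hz.continuous.continuousOn (s := Set.Icc (0 : ℝ) 1))
  set c := (∑ j, ‖weightVector A j‖) * R
  have hK : 0 < 2 + 2 * c ^ 2 * r ^ 2 := by positivity
  refine ⟨2 + 2 * c ^ 2 * r ^ 2, fun w hw => ?_⟩
  rw [← div_le_iff₀' hK]
  refine le_quotientLengthSq fun χ hχ => ?_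
  rw [div_le_iff₀' hK, l2Metric_incl_self hw, l2Metric_incl_sub_infGauge hz hw hχ]
  have hL := (contDiff_infAction A hz.1 hχ.1.1).continuous
  have hw_le := integral_norm_sq_le_two_mul_add hw hL
  have hL_le := integral_norm_sq_infAction_le (A := A) hz hχ hR
  set I := ∫ t in (0 : ℝ)..1, ‖w.1 t - infAction A (z t) (χ t)‖ ^ 2
  set P := ∫ t in (0 : ℝ)..1, ‖deriv χ t‖ ^ 2
  have hI : 0 ≤ I := intervalIntegral.integral_nonneg zero_le_one fun _ _ => sq_nonneg _
  have hP : 0 ≤ (1 / r) ^ 2 * P :=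
    mul_nonneg (sq_nonneg _) (intervalIntegral.integral_nonneg zero_le_one fun _ _ => sq_nonneg _)
  have hrP : P = r ^ 2 * ((1 / r) ^ 2 * P) := by field_simp
  have hcI : 0 ≤ c ^ 2 * r ^ 2 * (I + ‖w.2‖ ^ 2) := by positivity
  linear_combination hw_le + 2 * hL_le + 2 * c ^ 2 * hrP + 2 * hcI + 2 * hP + sq_nonneg ‖w.2‖

theorem eq_zero_of_quotientLengthSq_incl_nonpos (hr : r ≠ 0) (hz : IsSmoothLoop z)
    {w : (ℝ → CSpace n) × TorusLie k} (hw : IsSmoothLoop w.1)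
    (hQ : quotientLengthSq A r z (incl w) ≤ 0) : w = 0 := by
  obtain ⟨K, hK⟩ := exists_l2Metric_incl_self_le A hr hz
  have hQ_eq : quotientLengthSq A r z (incl w) = 0 :=
    hQ.antisymm (le_quotientLengthSq fun _ _ => l2Metric_self_nonneg _)
  have hle := hK w hw.continuous
  rw [hQ_eq, mul_zero, l2Metric_incl_self hw.continuous] at hle
  have hI : 0 ≤ ∫ t in (0 : ℝ)..1, ‖w.1 t‖ ^ 2 :=
    intervalIntegral.integral_nonneg zero_le_one fun _ _ => sq_nonneg _
  have hw₂ : ‖w.2‖ ^ 2 = 0 := by linarith [sq_nonneg ‖w.2‖]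
  have hw₁ : ∫ t in (0 : ℝ)..1, ‖w.1 t‖ ^ 2 = 0 := by linarith
  refine Prod.ext (funext fun t => ?_) (by simpa using hw₂)
  by_contra hne
  obtain ⟨t₀, ht₀, heq⟩ := hw.2.exists_mem_Ico₀ one_pos t
  refine (intervalIntegral.integral_pos zero_lt_one (hw.continuous.norm.fun_pow 2).continuousOn
    (fun _ _ => sq_nonneg _) ⟨t₀, Set.Ico_subset_Icc_self ht₀, ?_⟩).ne' hw₁
  rw [← heq]
  exact pow_pos (norm_pos_iff.2 hne) 2

theorem eq_of_forall_quotientMetric_eq (hr : r ≠ 0) (hz : IsSmoothLoop z)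
    {h : (ℝ → CSpace n) × (ℝ → TorusLie k)} (hh : Continuous h.1 ∧ Continuous h.2)
    (hor : ∀ χ ∈ lieGauge k, l2Metric h (infGauge A r z χ) = 0)
    {ξ : ℝ → TorusLie k} (hξ : ξ ∈ lieGauge k) {v G : (ℝ → CSpace n) × TorusLie k}
    (hv : IsSmoothLoop v.1) (hGs : IsSmoothLoop G.1) (hG : incl G = h + infGauge A r z ξ)
    (heq : ∀ w : (ℝ → CSpace n) × TorusLie k, IsSmoothLoop w.1 →
      quotientMetric A r z v w = l2Metric h (incl w)) : v = G := by
  have hu : IsSmoothLoop (v - G).1 := hv.sub hGs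
  have hw : IsSmoothLoop ((2 : ℝ) • (v - G)).1 := hu.const_smul 2
  have hpolar := heq (v - G) hu
  rw [quotientMetric, sub_sub_cancel, hG, quotientLengthSq_eq A r hz hh hξ hor,
    show v + (v - G) = G + (2 : ℝ) • (v - G) by rw [two_smul]; abel,
    show incl (G + (2 : ℝ) • (v - G)) = incl G + incl ((2 : ℝ) • (v - G)) from rfl, hG] at hpolar
  have hle := le_quotientLengthSq_horizontal_add hz hh
    (u := incl ((2 : ℝ) • (v - G))) ⟨hw.continuous, continuous_const⟩ hξ hor
  have htwo : l2Metric h (incl ((2 : ℝ) • (v - G))) = 2 * l2Metric h (incl (v - G)) := by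
    have hu' : Continuous (incl (v - G)).1 ∧ Continuous (incl (v - G)).2 :=
      ⟨hu.continuous, continuous_const⟩
    rw [two_smul, show incl (v - G + (v - G)) = incl (v - G) + incl (v - G) from rfl,
      l2Metric_comm, l2Metric_add_left hu' hu' hh, l2Metric_comm _ h, two_mul]
  have hzero := eq_zero_of_quotientLengthSq_incl_nonpos hr hz hw (by linarith)
  exact sub_eq_zero.1 ((smul_eq_zero.1 hzero).resolve_left two_ne_zero)

end QuotientMetric

section GradientFormula

variable {A : Matrix (Fin n) (Fin k) ℤ} {τ η : TorusLie k} {r : ℝ} {z : ℝ → CSpace n}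

/-- The normalized infinitesimal gauge transformation `ξ` with `∂ₜξ = r² (μ(z) - μ̄(z))`, which
moves the horizontal lift of the gradient of `𝒜₀` back into the tangent space of `ℒ₀`. -/
def gaugePotential (A : Matrix (Fin n) (Fin k) ℤ) (r : ℝ) (z : ℝ → CSpace n) : ℝ → TorusLie k :=
  meanZeroPrimitive fun t => r ^ 2 • (momentMap A (z t) - meanMoment A z)

theorem isSmoothLoop_smul_momentMap_sub_meanMoment (hz : IsSmoothLoop z) (c : ℝ) :
    IsSmoothLoop fun t => c • (momentMap A (z t) - meanMoment A z) :=
  ⟨(((contDiff_momentMap A).comp hz.1).sub contDiff_const).const_smul c,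
    fun t => by simp only [hz.2 t]⟩

theorem hasDerivAt_gaugePotential (hz : IsSmoothLoop z) (t : ℝ) :
    HasDerivAt (gaugePotential A r z) (r ^ 2 • (momentMap A (z t) - meanMoment A z)) t :=
  hasDerivAt_meanZeroPrimitive (isSmoothLoop_smul_momentMap_sub_meanMoment hz _).continuous t

theorem gaugePotential_mem_lieGauge (hz : IsSmoothLoop z) : gaugePotential A r z ∈ lieGauge k := by
  have hloop := isSmoothLoop_smul_momentMap_sub_meanMoment (A := A) hz (r ^ 2)
  refine ⟨hloop.meanZeroPrimitive ?_, integral_meanZeroPrimitive hloop.continuous⟩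
  rw [intervalIntegral.integral_smul, integral_momentMap_sub_meanMoment hz.continuous, smul_zero]

/-- The gradient of `𝒜₀` at the point `(z, η)` of `ℒ₀` with respect to the quotient metric
`g_r`. -/
def gradient (A : Matrix (Fin n) (Fin k) ℤ) (τ : TorusLie k) (r : ℝ)
    (z : ℝ → CSpace n) (η : TorusLie k) : (ℝ → CSpace n) × TorusLie k :=
  (fun t => Complex.I • covariantDeriv A z η t + infAction A (z t) (gaugePotential A r z t),
    meanMoment A z - τ)

theorem isSmoothLoop_gradient (hz : IsSmoothLoop z) : IsSmoothLoop (gradient A τ r z η).1 := by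
  have hξ := (gaugePotential_mem_lieGauge (A := A) (r := r) hz).1
  refine ⟨((hz.deriv.1.add (contDiff_infAction A hz.1 contDiff_const)).const_smul _).add
    (contDiff_infAction A hz.1 hξ.1), fun t => ?_⟩
  simp only [gradient, covariantDeriv, hz.2 t, hz.deriv.2 t, hξ.2 t]

theorem incl_gradient (hr : r ≠ 0) (hz : IsSmoothLoop z) :
    incl (gradient A τ r z η) =
      horizontalGradient A τ r z η + infGauge A r z (gaugePotential A r z) := by
  refine Prod.ext rfl (funext fun t => ?_)
  have hcancel : 1 / r * r ^ 2 = r := by field_simp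
  simp only [incl, gradient, horizontalGradient, infGauge, Prod.snd_add, Pi.add_apply,
    (hasDerivAt_gaugePotential hz t).deriv, smul_smul, hcancel, add_neg_cancel_right]

theorem IsGradient.eq_gradient (hr : r ≠ 0) (hz : IsSmoothLoop z)
    {v : (ℝ → CSpace n) × TorusLie k} (hv : IsGradient A τ r (z, η) v) :
    v = gradient A τ r z η :=
  eq_of_forall_quotientMetric_eq hr hz (continuous_horizontalGradient hz)
    (fun _ => l2Metric_horizontalGradient_infGauge hr hz) (gaugePotential_mem_lieGauge hz) hv.1
    (isSmoothLoop_gradient hz) (incl_gradient hr hz)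
    fun w hw => (hv.2 w hw).unique (hasDerivAt_action₀_horizontalGradient hz hw)

end GradientFormula

section FlowEquation

variable {A : Matrix (Fin n) (Fin k) ℤ} {τ : TorusLie k} {r : ℝ} {z : ℝ → ℝ → CSpace n}
  {η : ℝ → TorusLie k}

theorem IsFlowLine.isSmoothLoop (h : IsFlowLine A τ r z η) (s : ℝ) : IsSmoothLoop (z s) :=
  ⟨contDiff_slice_snd h.smooth_fst s, h.periodic s⟩

theorem IsFlowLine.deriv_fst (h : IsFlowLine A τ r z η) (hr : r ≠ 0) (s t : ℝ) :
    deriv (fun σ => z σ t) s = -(Complex.I • covariantDeriv A (z s) (η s) t +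
      infAction A (z s t) (gaugePotential A r (z s) t)) := by
  have heq := (h.flow s).eq_gradient hr (h.isSmoothLoop s)
  exact neg_eq_iff_eq_neg.1 (congrFun (congrArg Prod.fst heq) t)

theorem IsFlowLine.deriv_snd (h : IsFlowLine A τ r z η) (hr : r ≠ 0) (s : ℝ) :
    deriv η s = -(meanMoment A (z s) - τ) := by
  have heq := (h.flow s).eq_gradient hr (h.isSmoothLoop s)
  exact neg_eq_iff_eq_neg.1 (congrArg Prod.snd heq)

end FlowEquation

section Laplacian

theorem integral_cylinderLaplacian {u : ℝ → ℝ → ℝ} (hu : ContDiff ℝ 2 fun p : ℝ × ℝ => u p.1 p.2)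
    (hper : ∀ s, Function.Periodic (u s) 1) (s : ℝ) :
    ∫ t in (0 : ℝ)..1, cylinderLaplacian u s t =
      deriv (deriv fun σ => ∫ t in (0 : ℝ)..1, u σ t) s := by
  have hut : ContDiff ℝ 2 (u s) := contDiff_slice_snd hu s
  have huss : Continuous fun t => deriv (deriv fun σ => u σ t) s :=
    (contDiff_partial_fst (f := fun s t => deriv (fun σ => u σ t) s) (m := 0)
      (contDiff_partial_fst hu (m := 1) le_rfl) (by simp)).continuous.comp
      (Continuous.prodMk_right s)
  have hutt : Continuous (deriv (deriv (u s))) :=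
    ((contDiff_succ_iff_deriv (n := 1)).1 hut).2.2.continuous_deriv le_rfl
  simp only [cylinderLaplacian]
  rw [intervalIntegral.integral_add (huss.intervalIntegrable _ _) (hutt.intervalIntegrable _ _),
    integral_eq_zero_of_periodic (fun t => (hut.differentiable_deriv_two t).hasDerivAt) hutt
      (periodic_deriv (hper s)), add_zero, (hasDerivAt_deriv_integral_of_contDiff hu 0 1 s).deriv]

theorem cylinderLaplacian_sum {ι : Type*} (S : Finset ι) {u : ι → ℝ → ℝ → ℝ}
    (hu : ∀ j ∈ S, ContDiff ℝ 2 fun p : ℝ × ℝ => u j p.1 p.2) (s t : ℝ) :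
    cylinderLaplacian (fun s t => ∑ j ∈ S, u j s t) s t = ∑ j ∈ S, cylinderLaplacian (u j) s t := by
  have hsum {f : ι → ℝ → ℝ} (hf : ∀ j ∈ S, ContDiff ℝ 2 (f j)) (x : ℝ) :
      deriv (deriv fun y => ∑ j ∈ S, f j y) x = ∑ j ∈ S, deriv (deriv (f j)) x := by
    have hderiv : (deriv fun y => ∑ j ∈ S, f j y) = fun y => ∑ j ∈ S, deriv (f j) y :=
      funext fun y => deriv_fun_sum fun j hj => (hf j hj).differentiable two_ne_zero y
    rw [hderiv]
    exact deriv_fun_sum fun j hj => (hf j hj).differentiable_deriv_two x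
  simp only [cylinderLaplacian, Finset.sum_add_distrib]
  rw [hsum fun j hj => contDiff_slice_fst (hu j hj) t,
    hsum fun j hj => contDiff_slice_snd (hu j hj) s]

theorem inner_neg_I_mul_add (w d : ℂ) (a b : ℝ) :
    inner ℝ w (-(Complex.I * d) + (a - Complex.I * b) * w) =
      inner ℝ w (-(Complex.I * d)) + a * ‖w‖ ^ 2 := by
  simp only [← real_inner_self_eq_norm_sq, Complex.inner]
  simp only [Complex.mul_re, Complex.add_re, Complex.neg_re, Complex.I_re, zero_mul, Complex.I_im,
    one_mul, zero_sub, neg_neg, Complex.sub_re, Complex.ofReal_re, Complex.ofReal_im, mul_zero,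
    sub_self, sub_zero, Complex.sub_im, Complex.mul_im, zero_add, neg_mul, sub_neg_eq_add,
    Complex.conj_re, Complex.add_im, Complex.neg_im, Complex.conj_im, mul_neg, neg_add_rev]
  ring

variable {f : ℝ → ℝ → ℂ} {α : ℝ → ℝ} {β : ℝ → ℝ → ℝ}

-- The coefficient `β` drops out of `∂ₛ‖f‖²`, so its smoothness in `s` is never needed.
theorem deriv_norm_sq_of_deriv_eq {s t : ℝ} (hf : DifferentiableAt ℝ (fun σ => f σ t) s)
    (hflow : deriv (fun σ => f σ t) s =
      -(Complex.I * deriv (f s) t) + (α s - Complex.I * β s t) * f s t) :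
    deriv (fun σ => ‖f σ t‖ ^ 2) s =
      2 * (inner ℝ (f s t) (-(Complex.I * deriv (f s) t)) + α s * ‖f s t‖ ^ 2) := by
  rw [hf.hasDerivAt.norm_sq.deriv, hflow, inner_neg_I_mul_add]

theorem hasDerivAt_deriv_snd_of_deriv_eq (hf : ContDiff ℝ 2 fun p : ℝ × ℝ => f p.1 p.2)
    {β' s t : ℝ} (hβ : HasDerivAt (β s) β' t)
    (hflow : ∀ t, deriv (fun σ => f σ t) s =
      -(Complex.I * deriv (f s) t) + (α s - Complex.I * β s t) * f s t) :
    HasDerivAt (fun σ => deriv (f σ) t)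
      (-(Complex.I * deriv (deriv (f s)) t) +
        (-(Complex.I * β') * f s t + (α s - Complex.I * β s t) * deriv (f s) t)) s := by
  have hfs : ContDiff ℝ 2 (f s) := contDiff_slice_snd hf s
  refine ((contDiff_slice_fst (contDiff_partial_snd hf (m := 1) le_rfl) t).differentiable
    one_ne_zero s).hasDerivAt.congr_deriv ?_
  rw [deriv_partial_comm hf, funext hflow]
  exact (((hfs.differentiable_deriv_two t).hasDerivAt.const_mul _).neg.add
    (((hβ.ofReal_comp.const_mul _).const_sub _).mul
      (hfs.differentiable two_ne_zero t).hasDerivAt)).deriv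

theorem cylinderLaplacian_norm_sq_of_deriv_eq (hf : ContDiff ℝ 2 fun p : ℝ × ℝ => f p.1 p.2)
    {α' β' s t : ℝ} (hα : HasDerivAt α α' s) (hβ : HasDerivAt (β s) β' t)
    (hflow : ∀ s t, deriv (fun σ => f σ t) s =
      -(Complex.I * deriv (f s) t) + (α s - Complex.I * β s t) * f s t) :
    cylinderLaplacian (fun s t => ‖f s t‖ ^ 2) s t =
      4 * ‖deriv (f s) t + Complex.I * α s * f s t‖ ^ 2 + 2 * (α' - β') * ‖f s t‖ ^ 2 := by
  have hfs (σ : ℝ) : DifferentiableAt ℝ (fun σ => f σ t) σ :=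
    (contDiff_slice_fst hf t).differentiable two_ne_zero σ
  have hft (y : ℝ) : HasDerivAt (f s) (deriv (f s) y) y :=
    ((contDiff_slice_snd hf s).differentiable two_ne_zero y).hasDerivAt
  have hftt : HasDerivAt (deriv (f s)) (deriv (deriv (f s)) t) t :=
    ((contDiff_slice_snd hf s).differentiable_deriv_two t).hasDerivAt
  have hfts := hasDerivAt_deriv_snd_of_deriv_eq hf hβ (hflow s)
  have hs : (deriv fun σ => ‖f σ t‖ ^ 2) = _ :=
    funext fun σ => deriv_norm_sq_of_deriv_eq (hfs σ) (hflow σ t)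
  have ht := funext fun y => (hft y).norm_sq.deriv
  have hss := ((((hfs s).hasDerivAt.inner ℝ (hfts.const_mul Complex.I).neg).add
    (hα.mul (hfs s).hasDerivAt.norm_sq)).const_mul 2).deriv
  have htt := (((hft t).inner ℝ hftt).const_mul 2).deriv
  rw [cylinderLaplacian, hs, ht]
  refine (congrArg₂ (· + ·) hss htt).trans ?_
  simp only [hflow, ← real_inner_self_eq_norm_sq, Complex.inner]
  simp only [neg_mul, Complex.neg_re, Complex.mul_re, Complex.I_re, Complex.add_re, zero_mul,
    Complex.I_im, one_mul, zero_sub, neg_neg, Complex.ofReal_re, Complex.ofReal_im, mul_zero,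
    sub_self, Complex.mul_im, zero_add, Complex.sub_re, sub_zero, Complex.sub_im, sub_neg_eq_add,
    Complex.add_im, Complex.neg_im, neg_add_rev, Complex.conj_re, Complex.conj_im, mul_neg,
    Pi.neg_apply, map_add, map_neg, map_mul, Complex.conj_I, map_sub, Complex.conj_ofReal, add_zero,
    neg_zero, neg_sub]
  ring

end Laplacian

section FlowLaplacian

variable {A : Matrix (Fin n) (Fin k) ℤ} {τ : TorusLie k} {r : ℝ} {z : ℝ → ℝ → CSpace n}
  {η : ℝ → TorusLie k}

theorem hasDerivAt_weight (A : Matrix (Fin n) (Fin k) ℤ) {ξ : ℝ → TorusLie k} {ξ' : TorusLie k}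
    {t : ℝ} (hξ : HasDerivAt ξ ξ' t) (j : Fin n) :
    HasDerivAt (fun t => weight A (ξ t) j) (weight A ξ' j) t := by
  simp only [weight_eq_inner]
  simpa using (hasDerivAt_const t (weightVector A j)).inner ℝ hξ

theorem IsFlowLine.cylinderLaplacian_norm_sq_apply (h : IsFlowLine A τ r z η) (hr : r ≠ 0)
    (s t : ℝ) (j : Fin n) :
    cylinderLaplacian (fun s t => ‖z s t j‖ ^ 2) s t =
      4 * ‖covariantDeriv A (z s) (η s) t j‖ ^ 2 -
        2 * weight A (meanMoment A (z s) - τ +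
          r ^ 2 • (momentMap A (z s t) - meanMoment A (z s))) j * ‖z s t j‖ ^ 2 := by
  have hz : ContDiff ℝ 2 fun p : ℝ × ℝ => z p.1 p.2 := mod_cast contDiff_infty.1 h.smooth_fst 2
  have hs (s t : ℝ) := hasDerivAt_apply
    ((contDiff_slice_fst hz t).differentiable two_ne_zero s).hasDerivAt j
  have ht (s t : ℝ) := hasDerivAt_apply ((h.isSmoothLoop s).hasDerivAt t) j
  rw [cylinderLaplacian_norm_sq_of_deriv_eq (f := fun s t => z s t j)
    (β := fun s t => weight A (gaugePotential A r (z s) t) j) (by fun_prop)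
    (hasDerivAt_weight A (h.smooth_snd.differentiable (by simp) s).hasDerivAt j)
    (hasDerivAt_weight A (hasDerivAt_gaugePotential (r := r) (h.isSmoothLoop s) t) j)
    fun s t => ?_]
  · rw [(ht s t).deriv, h.deriv_snd hr]
    simp only [weight_eq_inner, inner_neg_right, inner_add_right, covariantDeriv, infAction,
      PiLp.add_apply]
    ring
  · rw [(hs s t).deriv, (ht s t).deriv, h.deriv_fst hr]
    simp only [covariantDeriv, infAction, PiLp.add_apply, PiLp.neg_apply, PiLp.smul_apply,
      smul_eq_mul]
    linear_combination -weight A (η s) j * z s t j * Complex.I_sq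

theorem IsFlowLine.cylinderLaplacian_norm_sq (h : IsFlowLine A τ r z η) (hr : r ≠ 0) (s t : ℝ) :
    cylinderLaplacian (fun s t => ‖z s t‖ ^ 2) s t =
      4 * ‖covariantDeriv A (z s) (η s) t‖ ^ 2 +
        4 * inner ℝ (momentMap A (z s t)) (meanMoment A (z s) - τ +
          r ^ 2 • (momentMap A (z s t) - meanMoment A (z s))) := by
  have hz : ContDiff ℝ 2 fun p : ℝ × ℝ => z p.1 p.2 := mod_cast contDiff_infty.1 h.smooth_fst 2
  simp only [EuclideanSpace.norm_sq_eq, inner_momentMap]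
  rw [cylinderLaplacian_sum (u := fun j s t => ‖z s t j‖ ^ 2) _ fun j _ =>
    ContDiff.norm_sq ℝ (by fun_prop)]
  simp only [h.cylinderLaplacian_norm_sq_apply hr, Finset.sum_sub_distrib, mul_assoc,
    Finset.mul_sum]
  rw [sub_eq_add_neg, ← Finset.sum_neg_distrib]
  congr 1
  exact Finset.sum_congr rfl fun j _ => by ring

end FlowLaplacian

section MomentGrowth

variable {A : Matrix (Fin n) (Fin k) ℤ} {τ : TorusLie k} {z : ℝ → CSpace n}

theorem exists_norm_sq_le_norm_momentMap (hA : IsProperMap (momentMap A)) :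
    ∃ c, 0 < c ∧ ∀ z, ‖z‖ ^ 2 ≤ c * ‖momentMap A z‖ := by
  obtain ⟨R, hRpos, hR⟩ := (hA.isCompact_preimage
    (isCompact_closedBall (0 : TorusLie k) 1)).isBounded.exists_pos_norm_lt
  refine ⟨R ^ 2, pow_pos hRpos 2, fun z => ?_⟩
  rcases eq_or_ne z 0 with rfl | hz
  · rw [norm_zero, zero_pow two_ne_zero]
    positivity
  have hzpos : 0 < ‖z‖ := norm_pos_iff.2 hz
  by_contra! hlt
  have hmem : (R / ‖z‖) • z ∈ momentMap A ⁻¹' Metric.closedBall 0 1 := by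
    rw [Set.mem_preimage, mem_closedBall_zero_iff, momentMap_smul, norm_smul, norm_pow, norm_div,
      norm_norm, Real.norm_of_nonneg hRpos.le, div_pow, div_mul_eq_mul_div,
      div_le_one (by positivity)]
    exact hlt.le
  refine (hR _ hmem).ne ?_
  rw [norm_smul, norm_div, norm_norm, Real.norm_of_nonneg hRpos.le, div_mul_cancel₀ _ hzpos.ne']

/-- The vector of the `L²`-norms of the coordinates of the loop `z`. Since the moment map depends
only on the squared moduli of the coordinates, its value there is the mean of `μ` along `z`. -/
def quadraticMean (z : ℝ → CSpace n) : CSpace n :=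
  WithLp.toLp 2 fun j => ((√(∫ t in (0 : ℝ)..1, ‖z t j‖ ^ 2) : ℝ) : ℂ)

theorem norm_quadraticMean_apply_sq (z : ℝ → CSpace n) (j : Fin n) :
    ‖quadraticMean z j‖ ^ 2 = ∫ t in (0 : ℝ)..1, ‖z t j‖ ^ 2 := by
  rw [quadraticMean, PiLp.toLp_apply, Complex.norm_real, Real.norm_eq_abs, sq_abs, Real.sq_sqrt
    (intervalIntegral.integral_nonneg zero_le_one fun t _ => sq_nonneg _)]

theorem norm_quadraticMean_sq (hz : Continuous z) :
    ‖quadraticMean z‖ ^ 2 = ∫ t in (0 : ℝ)..1, ‖z t‖ ^ 2 := by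
  simp only [EuclideanSpace.norm_sq_eq, norm_quadraticMean_apply_sq]
  rw [intervalIntegral.integral_finsetSum fun j _ =>
    Continuous.intervalIntegrable (by fun_prop) _ _]

theorem momentMap_quadraticMean (hz : Continuous z) :
    momentMap A (quadraticMean z) = meanMoment A z := by
  refine ext_inner_right ℝ fun ξ => ?_
  rw [meanMoment, real_inner_comm ξ, real_inner_comm ξ,
    ← integral_inner_const (continuous_momentMap_comp hz)]
  simp only [real_inner_comm (momentMap A _), inner_momentMap, norm_quadraticMean_apply_sq]
  rw [intervalIntegral.integral_const_mul, intervalIntegral.integral_finsetSum fun j _ =>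
    Continuous.intervalIntegrable (by fun_prop) _ _]
  simp only [intervalIntegral.integral_const_mul]

theorem integral_norm_sq_le_mul_norm_meanMoment {c : ℝ} (hc : ∀ z, ‖z‖ ^ 2 ≤ c * ‖momentMap A z‖)
    (hz : Continuous z) : ∫ t in (0 : ℝ)..1, ‖z t‖ ^ 2 ≤ c * ‖meanMoment A z‖ := by
  rw [← momentMap_quadraticMean hz, ← norm_quadraticMean_sq hz]
  exact hc _

theorem norm_meanMoment_le (hz : Continuous z) :
    ‖meanMoment A z‖ ≤ (∑ j, ‖weightVector A j‖) * ∫ t in (0 : ℝ)..1, ‖z t‖ ^ 2 := by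
  rw [← momentMap_quadraticMean hz, ← norm_quadraticMean_sq hz]
  exact norm_momentMap_le A _

theorem integral_inner_momentMap (hz : Continuous z) (ρ : ℝ) :
    ∫ t in (0 : ℝ)..1, inner ℝ (momentMap A (z t))
      (meanMoment A z - τ + ρ • (momentMap A (z t) - meanMoment A z)) =
      inner ℝ (meanMoment A z) (meanMoment A z - τ) +
        ρ * ∫ t in (0 : ℝ)..1, ‖momentMap A (z t) - meanMoment A z‖ ^ 2 := by
  have hv : Continuous fun t => momentMap A (z t) - meanMoment A z :=
    (continuous_momentMap_comp hz).sub continuous_const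
  have hmean := integral_momentMap_sub_meanMoment (A := A) hz
  set m := meanMoment A z
  have hsplit (t : ℝ) : inner ℝ (momentMap A (z t)) (m - τ + ρ • (momentMap A (z t) - m)) =
      inner ℝ m (m - τ) + inner ℝ (m - τ + ρ • m) (momentMap A (z t) - m) +
        ρ * ‖momentMap A (z t) - m‖ ^ 2 := by
    rw [← real_inner_self_eq_norm_sq]
    simp only [inner_add_left, inner_add_right, inner_sub_left, inner_sub_right,
      real_inner_smul_left, real_inner_smul_right, real_inner_comm (momentMap A (z t)),
      real_inner_comm m τ]
    ring
  simp only [hsplit]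
  rw [intervalIntegral.integral_add (Continuous.intervalIntegrable (by fun_prop) _ _)
      (Continuous.intervalIntegrable (by fun_prop) _ _),
    intervalIntegral.integral_add intervalIntegrable_const
      (Continuous.intervalIntegrable (by fun_prop) _ _),
    intervalIntegral.integral_const, integral_inner_const hv, hmean, inner_zero_right,
    intervalIntegral.integral_const_mul]
  simp

theorem inner_sub_add_smul_sub_ge {E : Type*} [NormedAddCommGroup E] [InnerProductSpace ℝ E]
    (x m y : E) {ρ P : ℝ} (hρ : 0 ≤ ρ) (hρP : ρ ≤ P) :
    -(‖x‖ * ((1 + P) * ‖m‖ + ‖y‖)) ≤ inner ℝ x (m - y + ρ • (x - m)) := by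
  have hsplit : inner ℝ x (m - y + ρ • (x - m)) = ρ * ‖x‖ ^ 2 - inner ℝ x (ρ • m + y - m) := by
    rw [← real_inner_self_eq_norm_sq]
    simp only [inner_add_right, inner_sub_right, real_inner_smul_right]
    ring
  have hnorm : ‖ρ • m + y - m‖ ≤ (1 + P) * ‖m‖ + ‖y‖ := by
    have htri := norm_sub_le_of_le (norm_add_le (ρ • m) y) (le_refl ‖m‖)
    rw [norm_smul, Real.norm_of_nonneg hρ] at htri
    linarith [mul_le_mul_of_nonneg_right hρP (norm_nonneg m)]
  have hinner := (real_inner_le_norm x (ρ • m + y - m)).trans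
    (mul_le_mul_of_nonneg_left hnorm (norm_nonneg x))
  rw [hsplit]
  linarith [mul_nonneg hρ (sq_nonneg ‖x‖)]

end MomentGrowth

section CovariantBound

variable {A : Matrix (Fin n) (Fin k) ℤ} {z : ℝ → CSpace n}

theorem inner_infAction_self (A : Matrix (Fin n) (Fin k) ℤ) (z : CSpace n) (ξ : TorusLie k) :
    inner ℝ z (infAction A z ξ) = 0 := by
  rw [PiLp.inner_apply]
  exact Finset.sum_eq_zero fun j _ => by
    simp only [infAction, Complex.inner, Complex.mul_re, Complex.I_re, Complex.ofReal_re,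
      zero_mul, Complex.I_im, Complex.ofReal_im, mul_zero, sub_self, Complex.mul_im, one_mul,
      zero_add, zero_sub, Complex.conj_re, neg_mul, Complex.conj_im, mul_neg, sub_neg_eq_add]
    ring

theorem abs_deriv_norm_sq_le {t : ℝ} (hz : DifferentiableAt ℝ z t) (η : TorusLie k) :
    |deriv (fun y => ‖z y‖ ^ 2) t| ≤ ‖z t‖ ^ 2 + ‖covariantDeriv A z η t‖ ^ 2 := by
  have hinner : inner ℝ (z t) (deriv z t) = inner ℝ (z t) (covariantDeriv A z η t) := by
    rw [covariantDeriv, inner_add_right, inner_infAction_self, add_zero]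
  rw [hz.hasDerivAt.norm_sq.deriv, hinner, abs_mul, abs_two]
  linarith [abs_real_inner_le_norm (z t) (covariantDeriv A z η t),
    two_mul_le_add_sq ‖z t‖ ‖covariantDeriv A z η t‖]

end CovariantBound

section FiniteEnergy

theorem exists_mem_norm_meanMoment_sub_le {A : Matrix (Fin n) (Fin k) ℤ} {τ : TorusLie k}
    {z : ℝ → ℝ → CSpace n} {η : ℝ → TorusLie k} (hE : energy A τ z η < ⊤) {S : Set ℝ}
    (hS : MeasurableSet S) (hvol : MeasureTheory.volume S = ⊤) :
    ∃ s ∈ S, ‖meanMoment A (z s) - τ‖ ≤ 1 := by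
  by_contra! hfar
  refine hE.not_ge ?_
  calc (⊤ : ENNReal) = ∫⁻ _ in S, 1 := by rw [MeasureTheory.setLIntegral_one, hvol]
    _ ≤ ∫⁻ s in S, ∫⁻ t in Set.Icc (0 : ℝ) 1, ENNReal.ofReal
        (‖deriv (z s) t + infAction A (z s t) (η s)‖ ^ 2 + ‖meanMoment A (z s) - τ‖ ^ 2) := by
        refine MeasureTheory.setLIntegral_mono' hS fun s hs => ?_
        calc (1 : ENNReal) = ∫⁻ _ in Set.Icc (0 : ℝ) 1, 1 := by simp
          _ ≤ _ := MeasureTheory.lintegral_mono fun t => ENNReal.one_le_ofReal.2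
            (le_add_of_nonneg_of_le (sq_nonneg _) (one_le_pow₀ (hfar s hs).le))
    _ ≤ energy A τ z η := MeasureTheory.setLIntegral_le_lintegral _ _

end FiniteEnergy

section FlowEstimates

variable {A : Matrix (Fin n) (Fin k) ℤ} {τ : TorusLie k} {r : ℝ} {z : ℝ → ℝ → CSpace n}
  {η : ℝ → TorusLie k}

theorem IsFlowLine.contDiff_norm_sq (h : IsFlowLine A τ r z η) :
    ContDiff ℝ 2 fun p : ℝ × ℝ => ‖z p.1 p.2‖ ^ 2 :=
  ContDiff.norm_sq ℝ (mod_cast contDiff_infty.1 h.smooth_fst 2)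

theorem IsFlowLine.continuous_norm_covariantDeriv_sq (h : IsFlowLine A τ r z η) (s : ℝ) :
    Continuous fun t => ‖covariantDeriv A (z s) (η s) t‖ ^ 2 :=
  (h.isSmoothLoop s).continuous_covariantDeriv.norm.pow 2

theorem IsFlowLine.deriv_deriv_integral_norm_sq_ge (h : IsFlowLine A τ r z η) (hr : r ≠ 0)
    (s : ℝ) :
    4 * (∫ t in (0 : ℝ)..1, ‖covariantDeriv A (z s) (η s) t‖ ^ 2) +
        4 * inner ℝ (meanMoment A (z s)) (meanMoment A (z s) - τ) ≤
      deriv (deriv fun σ => ∫ t in (0 : ℝ)..1, ‖z σ t‖ ^ 2) s := by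
  have hz := (h.isSmoothLoop s).continuous
  have hμ := continuous_momentMap_comp (A := A) hz
  rw [← integral_cylinderLaplacian (u := fun s t => ‖z s t‖ ^ 2) h.contDiff_norm_sq
    fun s t => by simp only [h.periodic s t]]
  simp only [h.cylinderLaplacian_norm_sq hr]
  rw [intervalIntegral.integral_add
      (((h.continuous_norm_covariantDeriv_sq s).const_mul 4).intervalIntegrable _ _)
      (Continuous.intervalIntegrable (by fun_prop) _ _),
    intervalIntegral.integral_const_mul, intervalIntegral.integral_const_mul,
    integral_inner_momentMap hz]
  have hvar : 0 ≤ ∫ t in (0 : ℝ)..1, ‖momentMap A (z s t) - meanMoment A (z s)‖ ^ 2 :=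
    intervalIntegral.integral_nonneg zero_le_one fun t _ => sq_nonneg _
  linarith [mul_nonneg (sq_nonneg r) hvar]

theorem IsFlowLine.integral_norm_sq_le (h : IsFlowLine A τ r z η) (hr : r ≠ 0) {c : ℝ}
    (hc0 : 0 < c) (hc : ∀ z, ‖z‖ ^ 2 ≤ c * ‖momentMap A z‖) (hE : energy A τ z η < ⊤) (s : ℝ) :
    ∫ t in (0 : ℝ)..1, ‖z s t‖ ^ 2 ≤ c * (‖τ‖ + 1) := by
  have hmass (s : ℝ) := integral_norm_sq_le_mul_norm_meanMoment hc (h.isSmoothLoop s).continuous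
  have hnear {S : Set ℝ} (hS : MeasurableSet S) (hvol : MeasureTheory.volume S = ⊤) :
      ∃ s ∈ S, ∫ t in (0 : ℝ)..1, ‖z s t‖ ^ 2 ≤ c * (‖τ‖ + 1) := by
    obtain ⟨s, hs, hle⟩ := exists_mem_norm_meanMoment_sub_le hE hS hvol
    refine ⟨s, hs, (hmass s).trans (mul_le_mul_of_nonneg_left ?_ hc0.le)⟩
    linarith [norm_le_norm_add_norm_sub' (meanMoment A (z s)) τ]
  refine le_of_deriv_deriv_pos_of_frequently_le
    (m := fun s => ∫ t in (0 : ℝ)..1, ‖z s t‖ ^ 2) ?_ (fun s hs => ?_) ?_ ?_ s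
  · exact continuous_iff_continuousAt.2 fun s => (hasDerivAt_integral_of_contDiff
      (f := fun s t => ‖z s t‖ ^ 2) (h.contDiff_norm_sq.of_le one_le_two) 0 1 s).continuousAt
  · have hm : ‖τ‖ + 1 < ‖meanMoment A (z s)‖ :=
      lt_of_mul_lt_mul_left (hs.trans_le (hmass s)) hc0.le
    have hinner : 0 < inner ℝ (meanMoment A (z s)) (meanMoment A (z s) - τ) := by
      rw [inner_sub_right, real_inner_self_eq_norm_sq]
      nlinarith [real_inner_le_norm (meanMoment A (z s)) τ, norm_nonneg τ]
    have hD : 0 ≤ ∫ t in (0 : ℝ)..1, ‖covariantDeriv A (z s) (η s) t‖ ^ 2 :=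
      intervalIntegral.integral_nonneg zero_le_one fun t _ => sq_nonneg _
    linarith [h.deriv_deriv_integral_norm_sq_ge hr s]
  · exact Filter.frequently_atBot.2 fun a => hnear measurableSet_Iic Real.volume_Iic
  · exact Filter.frequently_atTop.2 fun a => hnear measurableSet_Ici Real.volume_Ici

/-- The constant `C` in the inequality `-C‖z‖² ≤ Δ‖z‖²` along flow lines with parameter
`|r| ≤ R` whose loops have squared `L²`-norm at most `M`. -/
def laplacianConst (A : Matrix (Fin n) (Fin k) ℤ) (τ : TorusLie k) (R M : ℝ) : ℝ :=
  4 * ((∑ j, ‖weightVector A j‖) * ((1 + R ^ 2) * ((∑ j, ‖weightVector A j‖) * M) + ‖τ‖))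

theorem IsFlowLine.cylinderLaplacian_norm_sq_ge (h : IsFlowLine A τ r z η) (hr : r ≠ 0) {R : ℝ}
    (hrR : |r| ≤ R) {M s : ℝ} (hM : ∫ t in (0 : ℝ)..1, ‖z s t‖ ^ 2 ≤ M) (t : ℝ) :
    -laplacianConst A τ R M * ‖z s t‖ ^ 2 ≤ cylinderLaplacian (fun s t => ‖z s t‖ ^ 2) s t := by
  rw [laplacianConst]
  set C := ∑ j, ‖weightVector A j‖
  have hC : 0 ≤ C := Finset.sum_nonneg fun j _ => norm_nonneg _
  have hm : ‖meanMoment A (z s)‖ ≤ C * M :=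
    (norm_meanMoment_le (h.isSmoothLoop s).continuous).trans (mul_le_mul_of_nonneg_left hM hC)
  have hμ : ‖momentMap A (z s t)‖ * ((1 + R ^ 2) * ‖meanMoment A (z s)‖ + ‖τ‖) ≤
      C * ‖z s t‖ ^ 2 * ((1 + R ^ 2) * (C * M) + ‖τ‖) := by
    gcongr
    exact norm_momentMap_le A _
  rw [h.cylinderLaplacian_norm_sq hr]
  linarith [sq_nonneg ‖covariantDeriv A (z s) (η s) t‖, inner_sub_add_smul_sub_ge
    (momentMap A (z s t)) (meanMoment A (z s)) τ (sq_nonneg r) (sq_le_sq' (abs_le.1 hrR).1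
      (abs_le.1 hrR).2)]

theorem IsFlowLine.norm_sq_le (h : IsFlowLine A τ r z η) (hr : r ≠ 0) {R M : ℝ} (hrR : |r| ≤ R)
    (hM : ∀ s, ∫ t in (0 : ℝ)..1, ‖z s t‖ ^ 2 ≤ M) (s t : ℝ) :
    ‖z s t‖ ^ 2 ≤ 2 * (2 * M + (8 * M * (laplacianConst A τ R M + 1) ^ 2 + ‖τ‖ ^ 2) / 4) := by
  have hM0 : 0 ≤ M :=
    (intervalIntegral.integral_nonneg zero_le_one fun t _ => sq_nonneg _).trans (hM 0)
  have hK : 0 ≤ laplacianConst A τ R M := by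
    unfold laplacianConst
    positivity
  refine le_of_integral_le_of_cylinderLaplacian_ge (u := fun s t => ‖z s t‖ ^ 2)
    (D := fun s t => ‖covariantDeriv A (z s) (η s) t‖ ^ 2) hK
    h.contDiff_norm_sq (fun s t => by simp only [h.periodic s t]) (fun s t => sq_nonneg _)
    h.continuous_norm_covariantDeriv_sq hM
    (fun s t => h.cylinderLaplacian_norm_sq_ge hr hrR (hM s) t) (fun s => ?_)
    (fun s t => abs_deriv_norm_sq_le ((h.isSmoothLoop s).hasDerivAt t).differentiableAt (η s)) s t
  refine le_trans ?_ (h.deriv_deriv_integral_norm_sq_ge hr s)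
  rw [inner_sub_right, real_inner_self_eq_norm_sq]
  linarith [real_inner_le_norm (meanMoment A (z s)) τ,
    sq_nonneg (2 * ‖meanMoment A (z s)‖ - ‖τ‖)]

theorem mainTheorem6_general (A : Matrix (Fin n) (Fin k) ℤ) (τ : TorusLie k)
    (hproper : IsProperMap (momentMap A)) (R : ℝ) :
    ∃ K : Set (CSpace n), IsCompact K ∧ ∀ r : ℝ, r ≠ 0 → |r| ≤ R →
      ∀ (z : ℝ → ℝ → CSpace n) (η : ℝ → TorusLie k),
        IsFlowLine A τ r z η → energy A τ z η < ⊤ → ∀ s t : ℝ, z s t ∈ K := by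
  obtain ⟨c, hc0, hc⟩ := exists_norm_sq_le_norm_momentMap hproper
  set M := c * (‖τ‖ + 1)
  set B := 2 * (2 * M + (8 * M * (laplacianConst A τ R M + 1) ^ 2 + ‖τ‖ ^ 2) / 4)
  refine ⟨Metric.closedBall 0 √B, isCompact_closedBall _ _, fun r hr hrR z η h hE s t => ?_⟩
  have hmean : ∀ s, ∫ t in (0 : ℝ)..1, ‖z s t‖ ^ 2 ≤ M := h.integral_norm_sq_le hr hc0 hc hE
  have hbound : ‖z s t‖ ^ 2 ≤ B := h.norm_sq_le hr hrR hmean s t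
  exact mem_closedBall_zero_iff.2 (Real.le_sqrt_of_sq_le hbound)

end FlowEstimates

end MomentFloer

end

open MomentFloer in
theorem mainTheorem6 {n k : ℕ} (hkn : k ≤ n) (A : Matrix (Fin n) (Fin k) ℤ) (τ : TorusLie k)
    (hproper : IsProperMap (momentMap A)) (hregular : IsRegularValue (momentMap A) τ) :
    ∃ K : Set (CSpace n), IsCompact K ∧
      ∀ (r : ℝ), 0 < r → r ≤ 1 → ∀ (z : ℝ → ℝ → CSpace n) (η : ℝ → TorusLie k),
        IsFlowLine A τ r z η → energy A τ z η < ⊤ → ∀ s t : ℝ, z s t ∈ K :=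
  let ⟨K, hK, hflow⟩ := mainTheorem6_general A τ hproper 1
  ⟨K, hK, fun r hr hr1 => hflow r hr.ne' ((abs_of_pos hr).trans_le hr1)⟩
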